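/- Let $T>0$ and let $\Gamma(t)$, $t\in[0,T]$, be a closed (compact, without boundary), connected, oriented smooth surface in $\mathbb{R}^3$ that moves smoothly in time: the set $\bigcup_{t\in[0,T]}\Gamma(t)\times\{t\}$ is compact and near each of its points it is the zero set, in $\mathbb{R}^3\times[0,T]$, of a smooth function $\varphi(x,t)$ with $\nabla_x\varphi\neq0$. Let $\nu(\cdot,t)$ be the unit outward normal vector field of $\Gamma(t)$, let $V_\Gamma^N(\cdot,t)$ be the scalar outward normal velocity of $\Gamma(t)$, and put $S_T:=\bigcup_{t\in(0,T)}\Gamma(t)\times\{t\}$. For a function $f$ on $\Gamma(t)$ with a differentiable extension $\tilde f$ to a neighbourhood of $\Gamma(t)$ let $$\partial_i^{tan}f:=\sum_{j=1}^3(\delta_{ij}-\nu_i\nu_j)\,\partial_j\tilde f\quad(i=1,2,3),\qquad \nabla_\Gamma f:=(\partial_1^{tan}f,\partial_2^{tan}f,\partial_3^{tan}f)$$ on $\Gamma(t)$ (this does not depend on the extension). For a vector field $G$ and a $3\times3$ matrix-valued function $M$ on $\Gamma(t)$ let $\nabla_\Gamma G:=(\partial_i^{tan}G_j)_{i,j}$,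 $\mathrm{div}_\Gamma G:=\sum_i\partial_i^{tan}G_i$ and $[\mathrm{div}_\Gamma M]_j:=\sum_i\partial_i^{tan}M_{ij}$. Further let $$P_\Gamma:=I_3-\nu\otimes\nu,\qquad D^{tan}(G):=\tfrac12\{\nabla_\Gamma G+(\nabla_\Gamma G)^T\},\qquad H:=-\mathrm{div}_\Gamma\nu,\qquad |M|^2:=\sum_{i,j}M_{ij}^2 .$$ For a vector field $v$ on $S_T$ with $v\cdot\nu=V_\Gamma^N$ and a function $f$ on $S_T$ with a differentiable extension $\tilde f$ to a neighbourhood of $S_T$, the material derivative along $v$ is $\partial_v^\bullet f:=\partial_t\tilde f+(v\cdot\nabla)\tilde f$ on $S_T$ (again independent of the extension). Let $\mu_0>0$, let $v\colon S_T\to\mathbb{R}^3$ be of class $C^2$, $q\colon S_T\to\mathbb{R}$ of class $C^1$ and $q^1\colon S_T\to\mathbb{R}$ continuous. Suppose that $v\cdot\nu=V_\Gamma^N$ on $S_T$ and that $v$, $q$, $q^1$ satisfy the limit Navier–Stokes equations $$\partial_v^\bullet v+\nabla_\Gamma q+q^1\nu=2\mu_0\,\mathrm{div}_\Gamma\bigl(P_\Gamma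 D^{tan}(v)P_\Gamma\bigr),\qquad \mathrm{div}_\Gamma v=0\qquad\text{on } S_T.$$ Then for every $t\in(0,T)$ the integrals below are finite, the function $t\mapsto\int_{\Gamma(t)}\frac{|v|^2}{2}\,d\mathcal{H}^2$ is differentiable at $t$, and $$\frac{d}{dt}\int_{\Gamma(t)}\frac{|v|^2}{2}\,d\mathcal{H}^2=-2\mu_0\int_{\Gamma(t)}|P_\Gamma D^{tan}(v)P_\Gamma|^2\,d\mathcal{H}^2+\int_{\Gamma(t)}(qH-q^1)\,V_\Gamma^N\,d\mathcal{H}^2,$$ where $\mathcal{H}^2$ is the two-dimensional Hausdorff measure, normalized to be the surface area. -/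

import Mathlib

open MeasureTheory Set Filter Topology
open scoped ContDiff RealInnerProductSpace

noncomputable section

namespace MovingSurface

/-- Euclidean space `ℝ³`. -/
abbrev E3 : Type := EuclideanSpace ℝ (Fin 3)

/-! ### Moving surfaces -/

/-- The space-time surface `S_T = ⋃_{t ∈ (0,T)} Γ(t) × {t}`. -/
def spaceTime (T : ℝ) (Γ : ℝ → Set E3) : Set (E3 × ℝ) :=
  {p | p.2 ∈ Ioo 0 T ∧ p.1 ∈ Γ p.2}

/-- `Γ(t)`, `t ∈ [0,T]`, is a smoothly moving, closed (compact, without boundary), connected smooth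
surface in `ℝ³`: the set `⋃_{t ∈ [0,T]} Γ(t) × {t}` is compact and, near each of its points, it is
the zero set of a smooth function of `(x,t)` whose spatial gradient does not vanish. -/
structure IsMovingClosedSurface (T : ℝ) (Γ : ℝ → Set E3) : Prop where
  connected : ∀ t ∈ Icc 0 T, IsConnected (Γ t)
  compact : IsCompact {p : E3 × ℝ | p.2 ∈ Icc 0 T ∧ p.1 ∈ Γ p.2}
  smooth : ∀ t₀ ∈ Icc 0 T, ∀ y₀ ∈ Γ t₀, ∃ (U : Set (E3 × ℝ)) (φ : E3 × ℝ → ℝ),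
    IsOpen U ∧ (y₀, t₀) ∈ U ∧ ContDiffOn ℝ ∞ φ U ∧
    fderiv ℝ (fun x : E3 => φ (x, t₀)) y₀ ≠ 0 ∧
    ∀ p ∈ U, p.2 ∈ Icc 0 T → (p.1 ∈ Γ p.2 ↔ φ p = 0)

/-- `ν` is the (smooth) unit outward normal vector field of `Γ(t)`: it has length one, it is
orthogonal to the velocities of all curves in `Γ(t)`, and it points into the unbounded part of the
complement of `Γ(t)`. -/
structure IsUnitOutwardNormal (T : ℝ) (Γ : ℝ → Set E3) (ν : E3 × ℝ → E3) : Prop where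
  smooth : ContDiffOn ℝ ∞ ν (spaceTime T Γ)
  unit : ∀ p ∈ spaceTime T Γ, ‖ν p‖ = 1
  normal : ∀ p ∈ spaceTime T Γ, ∀ (c : ℝ → E3) (w : E3), HasDerivAt c w 0 → c 0 = p.1 →
    (∀ᶠ s in 𝓝 (0 : ℝ), c s ∈ Γ p.2) → ⟪w, ν p⟫ = 0
  outward : ∀ p ∈ spaceTime T Γ, ∀ᶠ s in 𝓝[>] (0 : ℝ),
    ¬ Bornology.IsBounded (connectedComponentIn (Γ p.2)ᶜ (p.1 + s • ν p))

/-- `V` is the scalar normal velocity of `Γ(t)` in the direction `ν`: a point that moves with the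
surface, `c(s) ∈ Γ(s)`, has at each time the normal velocity `c' · ν = V`. -/
def IsNormalVelocity (T : ℝ) (Γ : ℝ → Set E3) (ν : E3 × ℝ → E3) (V : E3 × ℝ → ℝ) : Prop :=
  ∀ p ∈ spaceTime T Γ, ∀ (c : ℝ → E3) (w : E3), HasDerivAt c w p.2 → c p.2 = p.1 →
    (∀ᶠ s in 𝓝 p.2, c s ∈ Γ s) → ⟪w, ν p⟫ = V p

/-- The material derivative `∂•_v f = ∂_t f + (v · ∇) f` of a function `f` on the space-time surface
`S_T` along `v`. It is the derivative of `f` as a function on `S_T` in the direction `(v, 1)`. When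
`v · ν` is the normal velocity this direction is tangent to `S_T`, so that the value depends on `f`
on `S_T` only, and it can be computed from any differentiable extension of `f`; along a trajectory
`c' = v(c, t)` on the moving surface it is the time derivative of `f(c(t), t)`. -/
def materialDeriv (T : ℝ) (Γ : ℝ → Set E3) (v f : E3 × ℝ → E3) (p : E3 × ℝ) : E3 :=
  fderivWithin ℝ f (spaceTime T Γ) p (v p, 1)

/-! ### Calculus on a fixed surface `S` with unit normal `n` -/

/-- The orthogonal projection `P = I - n ⊗ n` onto the tangent plane, as a matrix. -/
def tanProj (n : E3 → E3) (y : E3) : Matrix (Fin 3) (Fin 3) ℝ :=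
  1 - Matrix.of fun i j => n y i * n y j

/-- The `i`-th tangential derivative `∂ᵢᵗᵃⁿ f = ∑ⱼ (δᵢⱼ - nᵢ nⱼ) ∂ⱼ f`. It is the derivative of `f` as
a function on `S` in the direction of the tangent vector `P eᵢ`, so that it depends on `f` on `S`
only, and it can be computed from any differentiable extension of `f`. -/
def tanDeriv (S : Set E3) (n : E3 → E3) (i : Fin 3) (f : E3 → ℝ) (y : E3) : ℝ :=
  fderivWithin ℝ f S y (∑ j, tanProj n y i j • EuclideanSpace.single j (1 : ℝ))

/-- The tangential gradient `∇_Γ f` of a scalar function. -/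
def tanGrad (S : Set E3) (n : E3 → E3) (f : E3 → ℝ) (y : E3) : E3 :=
  WithLp.toLp 2 fun i => tanDeriv S n i f y

/-- The tangential gradient matrix `(∇_Γ G)ᵢⱼ = ∂ᵢᵗᵃⁿ Gⱼ` of a vector field. -/
def tanGradMatrix (S : Set E3) (n : E3 → E3) (G : E3 → E3) (y : E3) :
    Matrix (Fin 3) (Fin 3) ℝ :=
  Matrix.of fun i j => tanDeriv S n i (fun x => G x j) y

/-- The surface divergence `div_Γ G = ∑ᵢ ∂ᵢᵗᵃⁿ Gᵢ` of a vector field. -/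
def surfDiv (S : Set E3) (n : E3 → E3) (G : E3 → E3) (y : E3) : ℝ :=
  ∑ i, tanDeriv S n i (fun x => G x i) y

/-- The surface divergence `(div_Γ M)ⱼ = ∑ᵢ ∂ᵢᵗᵃⁿ Mᵢⱼ` of a matrix-valued function. -/
def surfDivMatrix (S : Set E3) (n : E3 → E3) (M : E3 → Matrix (Fin 3) (Fin 3) ℝ) (y : E3) : E3 :=
  WithLp.toLp 2 fun j => ∑ i, tanDeriv S n i (fun x => M x i j) y

/-- The tangential strain rate `Dᵗᵃⁿ(v) = (∇_Γ v + (∇_Γ v)ᵀ) / 2`. -/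
def tanStrain (S : Set E3) (n : E3 → E3) (v : E3 → E3) (y : E3) : Matrix (Fin 3) (Fin 3) ℝ :=
  (1 / 2 : ℝ) • (tanGradMatrix S n v y + (tanGradMatrix S n v y).transpose)

/-- The projected strain rate `P Dᵗᵃⁿ(v) P`. -/
def projStrain (S : Set E3) (n : E3 → E3) (v : E3 → E3) (y : E3) : Matrix (Fin 3) (Fin 3) ℝ :=
  tanProj n y * tanStrain S n v y * tanProj n y

/-- The mean curvature `H = - div_Γ n` (the sum of the principal curvatures). -/
def meanCurv (S : Set E3) (n : E3 → E3) (y : E3) : ℝ :=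
  - surfDiv S n n y

/-- The squared Frobenius norm `|M|² = ∑ᵢⱼ Mᵢⱼ²`. -/
def frobSq (M : Matrix (Fin 3) (Fin 3) ℝ) : ℝ :=
  ∑ i, ∑ j, M i j ^ 2

/-! ### The limit equations -/

/-- A time-dependent field at the fixed time `t`. -/
abbrev slice {F : Type} (f : E3 × ℝ → F) (t : ℝ) : E3 → F := fun x => f (x, t)

/-- The limit Navier–Stokes equations on the moving surface:
`∂•_v v + ∇_Γ q + q¹ ν = 2 μ₀ div_Γ (P_Γ Dᵗᵃⁿ(v) P_Γ)` and `div_Γ v = 0` on `S_T`. -/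
structure SolvesLimitNavierStokes (T μ₀ : ℝ) (Γ : ℝ → Set E3) (ν : E3 × ℝ → E3)
    (v : E3 × ℝ → E3) (q q₁ : E3 × ℝ → ℝ) : Prop where
  momentum : ∀ p ∈ spaceTime T Γ,
    materialDeriv T Γ v v p + tanGrad (Γ p.2) (slice ν p.2) (slice q p.2) p.1 + q₁ p • ν p =
      (2 * μ₀) • surfDivMatrix (Γ p.2) (slice ν p.2)
        (projStrain (Γ p.2) (slice ν p.2) (slice v p.2)) p.1
  continuity : ∀ p ∈ spaceTime T Γ, surfDiv (Γ p.2) (slice ν p.2) (slice v p.2) p.1 = 0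

end MovingSurface

end

open MovingSurface

noncomputable section

namespace MovingSurface

/-! The proof is the energy method. Pairing the momentum equation with `v` and applying the product
rule gives a pointwise balance (`energy_identity`): the material derivative of `|v|²/2` is the
surface divergence of the tangential field `energyFlux`, minus `2μ₀|PDP|²`, plus `(qH - q¹)V`. The
curvature enters through the pressure: only the tangential part of `v` is put into the flux, and
since `div v = 0` its divergence is `-div(Vν) = HV`. The transport theorem
`IsEvolution.hasDerivAt_setIntegral` brings the time derivative under the integral, and
`setIntegral_surfDiv_eq_zero` removes the flux.

The analytic weight lies in these two integral theorems. By the implicit function theorem the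
surface is locally a moving `C²` graph over a fixed plane (`exists_isChart`), and the area formula
`Frame.comap_graph_eq` turns surface integrals into plane integrals with density `jac`. There the
transport theorem is differentiation under the integral together with the vanishing integral of a
compactly supported plane divergence; a partition of unity makes it global.

The divergence theorem then comes for free. The function of time in the transport theorem does not
depend on the velocity field used to differentiate it, so with density `1` the velocities `w` and `w
+ Y`, for tangential `Y`, give the same derivative, whence `∫ div Y = 0`.

Derivatives within a surface are not unique as linear maps, but their values on its tangent cone
are; all differentiation is therefore done in tangent directions and computed in charts. -/

/-! ### Orthonormal frames and graphs over a plane. -/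

/-- The Euclidean plane. -/
abbrev E2 : Type := EuclideanSpace ℝ (Fin 2)

/-- The standard basis of the plane. -/
abbrev bvec (α : Fin 2) : E2 := EuclideanSpace.single α (1 : ℝ)

theorem E2.eq_sum (a : E2) : a = a 0 • bvec 0 + a 1 • bvec 1 := by
  ext i; fin_cases i <;> simp

theorem E2.inner_eq (a b : E2) : ⟪a, b⟫ = a 0 * b 0 + a 1 * b 1 := by
  simp [EuclideanSpace.inner_eq_star_dotProduct, dotProduct, Fin.sum_univ_two]
  ring

theorem clm_apply_eq_sum {F : Type*} [NormedAddCommGroup F] [NormedSpace ℝ F] (ℓ : E2 →L[ℝ] F)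
    (a : E2) : ℓ a = a 0 • ℓ (bvec 0) + a 1 • ℓ (bvec 1) := by
  conv_lhs => rw [E2.eq_sum a]
  simp only [map_add, map_smul]

/-- An orthonormal splitting of `ℝ³` into a plane, parametrized by `ι`, and a line along `e`. -/
structure Frame where
  ι : E2 →L[ℝ] E3
  e : E3
  inner_ι : ∀ a b, ⟪ι a, ι b⟫ = ⟪a, b⟫
  inner_ι_e : ∀ a, ⟪ι a, e⟫ = 0
  inner_e : ⟪e, e⟫ = 1
  span : ∀ y, ι (ContinuousLinearMap.adjoint ι y) + ⟪e, y⟫ • e = y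

namespace Frame

variable (F : Frame)

@[simp] theorem norm_e : ‖F.e‖ = 1 := by
  have h := F.inner_e
  rw [real_inner_self_eq_norm_sq] at h
  nlinarith [norm_nonneg F.e]

/-- The orthogonal projection onto the plane, in plane coordinates. -/
def π : E3 →L[ℝ] E2 := ContinuousLinearMap.adjoint F.ι

theorem split (y : E3) : F.ι (F.π y) + ⟪F.e, y⟫ • F.e = y := F.span y

theorem inner_π (y : E3) (a : E2) : ⟪F.π y, a⟫ = ⟪y, F.ι a⟫ :=
  ContinuousLinearMap.adjoint_inner_left _ _ _

@[simp] theorem π_ι (a : E2) : F.π (F.ι a) = a := by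
  refine ext_inner_right ℝ fun b => ?_
  rw [inner_π, inner_ι]

@[simp] theorem π_e : F.π F.e = 0 := by
  refine ext_inner_right ℝ fun b => ?_
  rw [inner_π, real_inner_comm, inner_ι_e, inner_zero_left]

theorem inner_e_ι (a : E2) : ⟪F.e, F.ι a⟫ = 0 := by rw [real_inner_comm, inner_ι_e]

theorem norm_sq_ι_add (a : E2) (c : ℝ) : ‖F.ι a + c • F.e‖ ^ 2 = ‖a‖ ^ 2 + c ^ 2 := by
  rw [← real_inner_self_eq_norm_sq, ← real_inner_self_eq_norm_sq a]
  simp only [inner_add_left, inner_add_right, inner_smul_left, inner_smul_right, F.inner_ι,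
    F.inner_ι_e, F.inner_e_ι, F.inner_e]
  simp; ring

theorem norm_le_ι_add (a : E2) (c : ℝ) : ‖a‖ ≤ ‖F.ι a + c • F.e‖ := by
  have := F.norm_sq_ι_add a c
  nlinarith [norm_nonneg a, norm_nonneg (F.ι a + c • F.e), sq_nonneg c]

/-- The parametrization of the graph of `h` over the plane of the frame. -/
def graph (h : E2 → ℝ) (x : E2) : E3 := F.ι x + h x • F.e

@[simp] theorem π_graph (h : E2 → ℝ) (x : E2) : F.π (F.graph h x) = x := by simp [graph]

@[simp] theorem inner_e_graph (h : E2 → ℝ) (x : E2) : ⟪F.e, F.graph h x⟫ = h x := by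
  simp [graph, inner_add_right, inner_smul_right, inner_e_ι]

theorem graph_injective (h : E2 → ℝ) : Function.Injective (F.graph h) :=
  Function.LeftInverse.injective (F.π_graph h)

theorem mem_range_graph {h : E2 → ℝ} {y : E3} : y ∈ range (F.graph h) ↔ ⟪F.e, y⟫ = h (F.π y) := by
  constructor
  · rintro ⟨x, rfl⟩; simp
  · intro hy
    exact ⟨F.π y, by rw [graph, ← hy, F.split]⟩

theorem continuous_graph {h : E2 → ℝ} (hh : Continuous h) : Continuous (F.graph h) := by
  unfold graph; fun_prop

/-- The tangent map of a graph whose height has the derivative `ℓ`. -/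
def tangentMap (ℓ : E2 →L[ℝ] ℝ) : E2 →L[ℝ] E3 := F.ι + ℓ.smulRight F.e

theorem tangentMap_apply (ℓ : E2 →L[ℝ] ℝ) (a : E2) : F.tangentMap ℓ a = F.ι a + ℓ a • F.e := rfl

theorem inner_tangentMap (ℓ : E2 →L[ℝ] ℝ) (a b : E2) :
    ⟪F.tangentMap ℓ a, F.tangentMap ℓ b⟫ = ⟪a, b⟫ + ℓ a * ℓ b := by
  simp only [tangentMap_apply, inner_add_left, inner_add_right, inner_smul_left, inner_smul_right,
    F.inner_ι, F.inner_ι_e, F.inner_e_ι, F.inner_e]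
  simp; ring

end Frame

/-! ### The area formula for graphs. -/

/-- The area density of a graph whose height has the derivative `ℓ`. -/
def areaDensity (ℓ : E2 →L[ℝ] ℝ) : ℝ := √(1 + ℓ (bvec 0) ^ 2 + ℓ (bvec 1) ^ 2)

theorem areaDensity_pos (ℓ : E2 →L[ℝ] ℝ) : 0 < areaDensity ℓ := by
  unfold areaDensity; positivity

theorem areaDensity_sq (ℓ : E2 →L[ℝ] ℝ) :
    areaDensity ℓ ^ 2 = 1 + ℓ (bvec 0) ^ 2 + ℓ (bvec 1) ^ 2 :=
  Real.sq_sqrt (by positivity)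

theorem continuous_areaDensity : Continuous areaDensity := by
  unfold areaDensity
  fun_prop

/-- The Gram determinant of the columns of `A`. -/
theorem det_sq_eq (A : E2 →ₗ[ℝ] E2) :
    LinearMap.det A ^ 2 =
      ⟪A (bvec 0), A (bvec 0)⟫ * ⟪A (bvec 1), A (bvec 1)⟫ - ⟪A (bvec 0), A (bvec 1)⟫ ^ 2 := by
  rw [← LinearMap.det_toMatrix (EuclideanSpace.basisFun (Fin 2) ℝ).toBasis A,
    Matrix.det_fin_two]
  simp only [LinearMap.toMatrix_apply, OrthonormalBasis.coe_toBasis, EuclideanSpace.basisFun_apply,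
    OrthonormalBasis.coe_toBasis_repr_apply, EuclideanSpace.basisFun_repr, E2.inner_eq]
  ring

theorem _root_.LipschitzOnWith.euclideanHausdorffMeasure_image_le {X Y : Type*} [EMetricSpace X]
    [MeasurableSpace X] [BorelSpace X] [EMetricSpace Y] [MeasurableSpace Y] [BorelSpace Y]
    {K : NNReal} {f : X → Y} {s : Set X} (hf : LipschitzOnWith K f s) (d : ℕ) :
    (μHE[d] : Measure Y) (f '' s) ≤ (K : ENNReal) ^ d * (μHE[d] : Measure X) s := by
  have h := hf.hausdorffMeasure_image_le (d := d) (by positivity)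
  simp only [Measure.euclideanHausdorffMeasure_def, Measure.smul_apply, ENNReal.smul_def,
    smul_eq_mul]
  rw [ENNReal.rpow_natCast] at h
  calc _ ≤ _ := mul_le_mul_right h _
    _ = _ := by ring

/-- The range of the tangent map is isometric to the plane, so the tangent map becomes an
endomorphism `A` of the plane. Its Gram matrix is the identity plus a rank-one term, with
determinant `1 + |ℓ|²`, which gives `|det A|`. -/
theorem Frame.measure_tangentMap_image (F : Frame) (ℓ : E2 →L[ℝ] ℝ) (B : Set E2) :
    (μHE[2] : Measure E3) (F.tangentMap ℓ '' B) = ENNReal.ofReal (areaDensity ℓ) * volume B := by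
  set L := F.tangentMap ℓ with hL
  have hinj : Function.Injective (L : E2 →ₗ[ℝ] E3) := by
    intro a b hab
    have := congrArg F.π hab
    simpa [hL, F.tangentMap_apply] using this
  set W := LinearMap.range (L : E2 →ₗ[ℝ] E3)
  have hW : Module.finrank ℝ W = 2 := by
    rw [LinearMap.finrank_range_of_inj hinj]; simp
  let r : W ≃ₗᵢ[ℝ] E2 := ((stdOrthonormalBasis ℝ W).reindex (finCongr hW)).repr
  let A : E2 →ₗ[ℝ] E2 := r.toLinearEquiv.toLinearMap ∘ₗ (L : E2 →ₗ[ℝ] E3).rangeRestrict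
  let ψ : E2 → E3 := fun a => (r.symm a : E3)
  have hψ : Isometry ψ := W.subtypeₗᵢ.isometry.comp r.symm.isometry
  have hψA : ∀ a, ψ (A a) = L a := by intro a; simp [ψ, A]
  have him : L '' B = ψ '' (A '' B) := by
    rw [image_image]; simp only [hψA]
  have hin : ∀ a b, ⟪A a, A b⟫ = ⟪a, b⟫ + ℓ a * ℓ b := by
    intro a b
    rw [← F.inner_tangentMap, ← hL, ← hψA, ← hψA]
    exact ((W.subtypeₗᵢ.comp r.symm.toLinearIsometry).inner_map_map _ _).symm
  have hdet : |LinearMap.det A| = areaDensity ℓ := by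
    have := det_sq_eq A
    rw [hin, hin, hin] at this
    rw [← abs_of_pos (areaDensity_pos ℓ), ← sq_eq_sq_iff_abs_eq_abs, areaDensity_sq, this]
    simp [EuclideanSpace.inner_single_left]
    ring
  rw [him, hψ.euclideanHausdorffMeasure_image, EuclideanSpace.euclideanHausdorffMeasure_eq_volume,
    Measure.addHaar_image_linearMap, hdet]

namespace Frame

variable (F : Frame) {h : E2 → ℝ}

/-- On a small ball the graph map differs from its tangent map by an `ε`-Lipschitz error, and
neither map shrinks distances. Hence the transfer maps between the two images, which go through `π`,
are `(1 + ε)`-Lipschitz in both directions. -/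
theorem exists_ball_measure_image (hh : ContDiff ℝ 1 h) (x : E2) {ε : NNReal} (hε : 0 < ε) :
    ∀ᶠ r in 𝓝[>] (0 : ℝ),
      (μHE[2] : Measure E3) (F.graph h '' Metric.closedBall x r) ≤ (1 + ε : NNReal) ^ 2 *
        (ENNReal.ofReal (areaDensity (fderiv ℝ h x)) * volume (Metric.closedBall x r)) ∧
      ENNReal.ofReal (areaDensity (fderiv ℝ h x)) * volume (Metric.closedBall x r) ≤
        (1 + ε : NNReal) ^ 2 * (μHE[2] : Measure E3) (F.graph h '' Metric.closedBall x r) := by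
  set L := F.tangentMap (fderiv ℝ h x) with hL
  have hst : HasStrictFDerivAt (F.graph h) L x := by
    have h1 := (hh.contDiffAt (x := x)).hasStrictFDerivAt one_ne_zero
    exact F.ι.hasStrictFDerivAt.add (h1.smul_const F.e)
  obtain ⟨s, hs, hap⟩ := hst.approximates_deriv_on_nhds (c := ε) (Or.inr hε)
  obtain ⟨R, hR, hRs⟩ := Metric.nhds_basis_closedBall.mem_iff.1 hs
  have hmem : Ioc 0 R ∈ 𝓝[>] (0 : ℝ) := Ioc_mem_nhdsGT hR
  filter_upwards [hmem] with r hr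
  set B := Metric.closedBall x r
  have hBs : B ⊆ s := (Metric.closedBall_subset_closedBall hr.2).trans hRs
  have hest : ∀ a ∈ B, ∀ b ∈ B, ‖F.graph h a - F.graph h b - L (a - b)‖ ≤ ε * ‖a - b‖ :=
    fun a ha b hb => hap a (hBs ha) b (hBs hb)
  have hπL : ∀ a, F.π (L a) = a := by intro a; simp [hL, F.tangentMap_apply]
  have hLn : ∀ a, ‖a‖ ≤ ‖L a‖ := fun a => F.norm_le_ι_add a _
  have hΦn : ∀ a b, ‖a - b‖ ≤ ‖F.graph h a - F.graph h b‖ := by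
    intro a b
    have : F.graph h a - F.graph h b = F.ι (a - b) + (h a - h b) • F.e := by
      simp only [graph, map_sub, sub_smul]; abel
    rw [this]; exact F.norm_le_ι_add _ _
  constructor
  · have hlip : LipschitzOnWith (1 + ε) (F.graph h ∘ F.π) (L '' B) := by
      refine LipschitzOnWith.of_dist_le_mul ?_
      rintro _ ⟨a, ha, rfl⟩ _ ⟨b, hb, rfl⟩
      simp only [Function.comp, hπL, dist_eq_norm, NNReal.coe_add, NNReal.coe_one]
      have h1 := hest a ha b hb
      have h2 := norm_le_norm_sub_add (F.graph h a - F.graph h b) (L (a - b))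
      have h3 := hLn (a - b)
      rw [← map_sub]
      nlinarith [ε.2, mul_le_mul_of_nonneg_left h3 ε.coe_nonneg]
    have := hlip.euclideanHausdorffMeasure_image_le 2
    rwa [F.measure_tangentMap_image, image_image,
      show (fun a => (F.graph h ∘ F.π) (L a)) = F.graph h by
        funext a; simp [hπL]] at this
  · have hlip : LipschitzOnWith (1 + ε) (L ∘ F.π) (F.graph h '' B) := by
      refine LipschitzOnWith.of_dist_le_mul ?_
      rintro _ ⟨a, ha, rfl⟩ _ ⟨b, hb, rfl⟩
      simp only [Function.comp, π_graph, dist_eq_norm, NNReal.coe_add, NNReal.coe_one]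
      have h1 := hest a ha b hb
      have h2 := norm_le_norm_sub_add (L (a - b)) (F.graph h a - F.graph h b)
      rw [norm_sub_rev (L (a - b))] at h2
      have h3 := hΦn a b
      rw [← map_sub]
      nlinarith [ε.2, mul_le_mul_of_nonneg_left h3 ε.coe_nonneg]
    have := hlip.euclideanHausdorffMeasure_image_le 2
    rwa [image_image, show (fun a => (L ∘ F.π) (F.graph h a)) = L by
        funext a; simp, F.measure_tangentMap_image] at this

theorem exists_lipschitzOn_ball (hh : ContDiff ℝ 1 h) (x : E2) :
    ∃ K : NNReal, ∃ s ∈ 𝓝 x, LipschitzOnWith K (F.graph h) s := by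
  have h1 := (hh.contDiffAt (x := x)).hasStrictFDerivAt one_ne_zero
  exact (F.ι.hasStrictFDerivAt.add (h1.smul_const F.e)).exists_lipschitzOnWith

theorem measurableEmbedding_graph (hh : ContDiff ℝ 1 h) : MeasurableEmbedding (F.graph h) :=
  (F.continuous_graph hh.continuous).measurableEmbedding (F.graph_injective h)

theorem comap_graph_apply (hh : ContDiff ℝ 1 h) (A : Set E2) :
    (μHE[2] : Measure E3).comap (F.graph h) A = (μHE[2] : Measure E3) (F.graph h '' A) :=
  (F.measurableEmbedding_graph hh).comap_apply _ _

theorem comap_graph_absolutelyContinuous (hh : ContDiff ℝ 1 h) :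
    (μHE[2] : Measure E3).comap (F.graph h) ≪ volume := by
  intro A hA
  refine measure_null_of_locally_null A fun x _ => ?_
  obtain ⟨K, s, hs, hK⟩ := F.exists_lipschitzOn_ball hh x
  refine ⟨A ∩ s, inter_mem_nhdsWithin A hs, ?_⟩
  rw [F.comap_graph_apply hh]
  have := (hK.mono (inter_subset_right : A ∩ s ⊆ s)).euclideanHausdorffMeasure_image_le 2
  rw [EuclideanSpace.euclideanHausdorffMeasure_eq_volume,
    measure_mono_null inter_subset_left hA, mul_zero] at this
  exact le_antisymm this bot_le

theorem isLocallyFiniteMeasure_comap_graph (hh : ContDiff ℝ 1 h) :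
    IsLocallyFiniteMeasure ((μHE[2] : Measure E3).comap (F.graph h)) := by
  refine ⟨fun x => ?_⟩
  obtain ⟨K, s, hs, hK⟩ := F.exists_lipschitzOn_ball hh x
  obtain ⟨R, hR, hRs⟩ := Metric.nhds_basis_closedBall.mem_iff.1 hs
  refine ⟨Metric.closedBall x R, Metric.closedBall_mem_nhds x hR, ?_⟩
  rw [F.comap_graph_apply hh]
  have := (hK.mono hRs).euclideanHausdorffMeasure_image_le 2
  rw [EuclideanSpace.euclideanHausdorffMeasure_eq_volume] at this
  refine this.trans_lt (ENNReal.mul_lt_top (by simp) ?_)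
  exact (isCompact_closedBall x R).measure_lt_top

/-- The area formula for graphs. -/
theorem comap_graph_eq (hh : ContDiff ℝ 1 h) :
    (μHE[2] : Measure E3).comap (F.graph h) =
      volume.withDensity fun x => ENNReal.ofReal (areaDensity (fderiv ℝ h x)) := by
  set m := (μHE[2] : Measure E3).comap (F.graph h)
  have := F.isLocallyFiniteMeasure_comap_graph hh
  have hac := F.comap_graph_absolutelyContinuous hh
  rw [← Measure.withDensity_rnDeriv_eq m volume hac]
  refine withDensity_congr_ae ?_
  -- The density is almost everywhere the limit of ratios on shrinking balls. These ratios are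
  -- squeezed up to the factor `(1 + ε)²`, and then `ε` tends to `0`.
  filter_upwards [Besicovitch.ae_tendsto_rnDeriv m volume] with x hx
  set D := m.rnDeriv volume x
  set J := ENNReal.ofReal (areaDensity (fderiv ℝ h x))
  have hvol : ∀ r ∈ Ioi (0 : ℝ), volume (Metric.closedBall x r) ≠ 0 ∧
      volume (Metric.closedBall x r) ≠ ⊤ := fun r hr =>
    ⟨(Metric.measure_closedBall_pos volume x hr).ne', (isCompact_closedBall x r).measure_lt_top.ne⟩
  have hbounds : ∀ ε : NNReal, 0 < ε → D ≤ (1 + ε : NNReal) ^ 2 * J ∧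
      J ≤ (1 + ε : NNReal) ^ 2 * D := by
    intro ε hε
    have hev := F.exists_ball_measure_image hh x hε
    constructor
    · refine le_of_tendsto hx ?_
      filter_upwards [hev, self_mem_nhdsWithin] with r hr hr0
      rw [F.comap_graph_apply hh]
      refine ENNReal.div_le_of_le_mul ?_
      rw [mul_assoc]; exact hr.1
    · refine ge_of_tendsto (ENNReal.Tendsto.const_mul hx (Or.inr (by finiteness))) ?_
      filter_upwards [hev, self_mem_nhdsWithin] with r hr hr0
      rw [F.comap_graph_apply hh, ← mul_div_assoc,
        ENNReal.le_div_iff_mul_le (Or.inl (hvol r hr0).1) (Or.inl (hvol r hr0).2)]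
      exact hr.2
  have hlim : ∀ c : ENNReal, Tendsto (fun ε : NNReal => ((1 + ε : NNReal) : ENNReal) ^ 2 * c)
      (𝓝[>] 0) (𝓝 c) := by
    intro c
    have h1 : Tendsto (fun ε : NNReal => ((1 + ε : NNReal) : ENNReal) ^ 2) (𝓝[>] 0) (𝓝 1) := by
      have : Continuous fun ε : NNReal => (((1 + ε) ^ 2 : NNReal) : ENNReal) := by fun_prop
      have h2 := (this.tendsto 0).mono_left (nhdsWithin_le_nhds (s := Ioi 0))
      simpa using h2
    simpa using ENNReal.Tendsto.mul_const h1 (Or.inl one_ne_zero) (b := c)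
  refine le_antisymm ?_ ?_
  · refine ge_of_tendsto (hlim J) ?_
    filter_upwards [self_mem_nhdsWithin] with ε hε using (hbounds ε hε).1
  · refine ge_of_tendsto (hlim D) ?_
    filter_upwards [self_mem_nhdsWithin] with ε hε using (hbounds ε hε).2

theorem measure_graph_image (hh : ContDiff ℝ 1 h) {A : Set E2} (hA : MeasurableSet A) :
    (μHE[2] : Measure E3) (F.graph h '' A) =
      ∫⁻ x in A, ENNReal.ofReal (areaDensity (fderiv ℝ h x)) := by
  rw [← F.comap_graph_apply hh, F.comap_graph_eq hh, withDensity_apply _ hA]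

theorem setIntegral_graph (hh : ContDiff ℝ 1 h) (f : E3 → ℝ) :
    ∫ y in range (F.graph h), f y ∂μHE[2] =
      ∫ x, f (F.graph h x) * areaDensity (fderiv ℝ h x) := by
  have hme := F.measurableEmbedding_graph hh
  have h1 : (μHE[2] : Measure E3).restrict (range (F.graph h)) =
      ((μHE[2] : Measure E3).comap (F.graph h)).map (F.graph h) := by
    rw [hme.map_comap]
  have hJ : Measurable fun x => areaDensity (fderiv ℝ h x) :=
    (continuous_areaDensity.comp (hh.continuous_fderiv one_ne_zero)).measurable
  rw [h1, hme.integral_map, F.comap_graph_eq hh]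
  rw [integral_withDensity_eq_integral_toReal_smul hJ.ennreal_ofReal (by simp)]
  refine integral_congr_ae (Eventually.of_forall fun x => ?_)
  simp only [smul_eq_mul, ENNReal.toReal_ofReal (areaDensity_pos _).le, mul_comm]

end Frame

/-! ### Local description of the moving surface as a moving graph. -/

theorem exists_frame {e : E3} (he : ‖e‖ = 1) : ∃ F : Frame, F.e = e := by
  have he0 : e ≠ 0 := by rintro rfl; simp at he
  have hee : ⟪e, e⟫ = 1 := by rw [real_inner_self_eq_norm_sq, he]; norm_num
  have : Fact (Module.finrank ℝ E3 = 2 + 1) := ⟨by simp⟩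
  let b := OrthonormalBasis.fromOrthogonalSpanSingleton (𝕜 := ℝ) 2 he0
  let j : E2 →ₗᵢ[ℝ] E3 := (ℝ ∙ e)ᗮ.subtypeₗᵢ.comp b.repr.symm.toLinearIsometry
  let ι : E2 →L[ℝ] E3 := j.toContinuousLinearMap
  have h1 : ∀ a b, ⟪ι a, ι b⟫ = ⟪a, b⟫ := fun a b => j.inner_map_map a b
  have h2 : ∀ a, ⟪ι a, e⟫ = 0 := fun a => by
    have : (b.repr.symm a : E3) ∈ (ℝ ∙ e)ᗮ := (b.repr.symm a).2
    rw [Submodule.mem_orthogonal_singleton_iff_inner_left] at this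
    exact this
  refine ⟨⟨ι, e, h1, h2, hee, fun y => ?_⟩, rfl⟩
  have hz : y - ⟪e, y⟫ • e ∈ (ℝ ∙ e)ᗮ := by
    rw [Submodule.mem_orthogonal_singleton_iff_inner_right, inner_sub_right, inner_smul_right, hee]
    simp
  have hy : y = ι (b.repr ⟨_, hz⟩) + ⟪e, y⟫ • e := by
    have : ι (b.repr ⟨_, hz⟩) = y - ⟪e, y⟫ • e := by simp [ι, j]
    rw [this]; abel
  have had : ContinuousLinearMap.adjoint ι y = b.repr ⟨_, hz⟩ := by
    refine ext_inner_right ℝ fun a => ?_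
    rw [ContinuousLinearMap.adjoint_inner_left]
    conv_lhs => rw [hy]
    rw [inner_add_left, inner_smul_left, h1, real_inner_comm (ι a) e, h2]
    simp
  rw [had]; exact hy.symm

theorem natCast_le_infty (n : ℕ) : (n : WithTop ℕ∞) ≤ ∞ := by
  exact_mod_cast (le_top : (n : ℕ∞) ≤ ⊤)

theorem two_le_infty : (2 : WithTop ℕ∞) ≤ ∞ := natCast_le_infty 2

/-- A function that is `C²` at a point agrees near this point with a globally `C²` function. -/
theorem exists_contDiff_eventuallyEq {E : Type*} [NormedAddCommGroup E] [NormedSpace ℝ E]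
    [FiniteDimensional ℝ E] {f : E → ℝ} {x : E} (hf : ContDiffAt ℝ 2 f x) :
    ∃ g : E → ℝ, ContDiff ℝ 2 g ∧ g =ᶠ[𝓝 x] f := by
  obtain ⟨R, hR, hRs⟩ := Metric.nhds_basis_closedBall.mem_iff.1 (hf.eventually (by simp))
  let χ : ContDiffBump x := ⟨R / 2, R, by positivity, by linarith⟩
  refine ⟨fun y => χ y * f y, contDiff_iff_contDiffAt.2 fun y => ?_, ?_⟩
  · by_cases hy : y ∈ tsupport χ
    · rw [χ.tsupport_eq] at hy
      exact χ.contDiffAt.mul (hRs hy)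
    · refine contDiffAt_const (c := (0 : ℝ)) |>.congr_of_eventuallyEq ?_
      filter_upwards [notMem_tsupport_iff_eventuallyEq.1 hy] with z hz
      rw [hz]; simp
  · filter_upwards [χ.eventuallyEq_one] with y hy
    rw [hy]; simp

/-- The moving surface is, in the open set `W` and for times in `I`, the graph of `h` over the plane
of the frame `F`. -/
structure IsChart (T : ℝ) (Γ : ℝ → Set E3) (F : Frame) (h : E2 × ℝ → ℝ) (W : Set E3)
    (I : Set ℝ) : Prop where
  contDiff : ContDiff ℝ 2 h
  isOpen_space : IsOpen W
  isOpen_time : IsOpen I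
  time_subset : I ⊆ Ioo 0 T
  mem_iff : ∀ t ∈ I, ∀ y ∈ W, (y ∈ Γ t ↔ ⟪F.e, y⟫ = h (F.π y, t))

/-- The frame is aligned with a direction in which the defining function has nonzero spatial
derivative, and the zero set is solved for the height with plane point and time as parameters. The
implicit function is replaced by a globally `C²` one with the same germ, which spares later
arguments a domain for `h`. -/
theorem exists_isChart {T : ℝ} {Γ : ℝ → Set E3} (hΓ : IsMovingClosedSurface T Γ) {t₀ : ℝ}
    (ht₀ : t₀ ∈ Ioo 0 T) {y₀ : E3} (hy₀ : y₀ ∈ Γ t₀) :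
    ∃ F h W I, IsChart T Γ F h W I ∧ y₀ ∈ W ∧ t₀ ∈ I := by
  obtain ⟨U, φ, hU, hmem, hφ, hne, hiff⟩ := hΓ.smooth t₀ (Ioo_subset_Icc_self ht₀) y₀ hy₀
  have hφat : ContDiffAt ℝ 2 φ (y₀, t₀) :=
    (hφ.contDiffAt (hU.mem_nhds hmem)).of_le two_le_infty
  set φ' := fderiv ℝ φ (y₀, t₀)
  have hφ' : HasFDerivAt φ φ' (y₀, t₀) := (hφat.differentiableAt (by simp)).hasFDerivAt
  have hsl : HasFDerivAt (fun x : E3 => φ (x, t₀)) (φ'.comp (ContinuousLinearMap.inl ℝ E3 ℝ)) y₀ :=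
    hφ'.comp y₀ (hasFDerivAt_prodMk_left y₀ t₀)
  rw [hsl.fderiv] at hne
  obtain ⟨u, hu⟩ : ∃ u, φ' (u, 0) ≠ 0 := by
    by_contra! hcon
    exact hne (by ext u; simpa using hcon u)
  have hu0 : u ≠ 0 := by
    rintro rfl
    exact hu (map_zero φ')
  obtain ⟨F, hFe⟩ := exists_frame (e := (‖u‖⁻¹ : ℝ) • u) (by simp [norm_smul, hu0])
  have hFe0 : φ' (F.e, 0) ≠ 0 := by
    have : ((F.e, 0) : E3 × ℝ) = (‖u‖⁻¹ : ℝ) • (u, 0) := by simp [hFe]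
    rw [this, map_smul]
    exact smul_ne_zero (by simpa using hu0) hu
  let g : (E2 × ℝ) × ℝ → E3 × ℝ := fun p => (F.ι p.1.1 + p.2 • F.e, p.1.2)
  let g' : (E2 × ℝ) × ℝ →L[ℝ] E3 × ℝ :=
    (F.ι.comp ((ContinuousLinearMap.fst ℝ E2 ℝ).comp (ContinuousLinearMap.fst ℝ (E2 × ℝ) ℝ)) +
      (ContinuousLinearMap.snd ℝ (E2 × ℝ) ℝ).smulRight F.e).prod
      ((ContinuousLinearMap.snd ℝ E2 ℝ).comp (ContinuousLinearMap.fst ℝ (E2 × ℝ) ℝ))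
  have hgg' : g = g' := by funext p; simp [g, g']
  let p₀ : (E2 × ℝ) × ℝ := ((F.π y₀, t₀), ⟪F.e, y₀⟫)
  have hgp : g p₀ = (y₀, t₀) := by simp only [g, p₀, F.split]
  have hgc : ContDiff ℝ 2 g := by rw [hgg']; exact g'.contDiff
  have hf : ContDiffAt ℝ 2 (φ ∘ g) p₀ := ContDiffAt.comp p₀ (by rwa [hgp]) hgc.contDiffAt
  have hfd : fderiv ℝ (φ ∘ g) p₀ = φ'.comp g' := by
    refine HasFDerivAt.fderiv (HasFDerivAt.comp p₀ (by rwa [hgp]) ?_)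
    rw [hgg']; exact g'.hasFDerivAt
  have hinv : (fderiv ℝ (φ ∘ g) p₀ ∘L .inr ℝ (E2 × ℝ) ℝ).IsInvertible := by
    -- The partial derivative in the height variable is multiplication by the nonzero number `φ'
    -- (F.e, 0)`.
    refine ⟨ContinuousLinearEquiv.unitsEquivAut ℝ (Units.mk0 _ hFe0), ?_⟩
    ext
    rw [hfd]
    simp [g']
  obtain ⟨h, hh, hheq⟩ := exists_contDiff_eventuallyEq
    (hf.contDiffAt_implicitFunction (by simp) hinv)
  have hev := hf.eventually_apply_eq_iff_implicitFunction (by simp) hinv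
  have hφ0 : φ (y₀, t₀) = 0 := (hiff _ hmem (Ioo_subset_Icc_self ht₀)).1 hy₀
  let k : E3 × ℝ → (E2 × ℝ) × ℝ := fun p => ((F.π p.1, p.2), ⟪F.e, p.1⟫)
  have hk : Continuous k := by fun_prop
  have hgk : ∀ p, g (k p) = p := by
    intro p; simp only [g, k, F.split]
  have hev2 : ∀ᶠ p : E3 × ℝ in 𝓝 (y₀, t₀), p.2 ∈ Ioo 0 T ∧
      (p.1 ∈ Γ p.2 ↔ ⟪F.e, p.1⟫ = h (F.π p.1, p.2)) := by
    have e1 := (hk.tendsto (y₀, t₀)).eventually hev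
    have e2 := (hk.tendsto (y₀, t₀)).eventually
      ((continuous_fst.tendsto p₀).eventually hheq)
    have e3 := (continuous_snd.tendsto (y₀, t₀)).eventually (isOpen_Ioo.mem_nhds ht₀)
    filter_upwards [e1, e2, e3, hU.mem_nhds hmem] with p h1 h2 h3 h4
    refine ⟨h3, ?_⟩
    rw [hiff p h4 (Ioo_subset_Icc_self h3)]
    simp only [Function.comp, hgk, hgp, hφ0] at h1
    rw [h1, ← h2, eq_comm]
  rw [nhds_prod_eq] at hev2
  obtain ⟨W, hW, I, hI, hWI⟩ := Filter.mem_prod_iff.1 hev2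
  obtain ⟨W', hW'W, hW'o, hW'm⟩ := mem_nhds_iff.1 hW
  obtain ⟨I', hI'I, hI'o, hI'm⟩ := mem_nhds_iff.1 hI
  refine ⟨F, h, W', I', ⟨hh, hW'o, hI'o, fun t ht => ?_, fun t ht y hy => ?_⟩, hW'm, hI'm⟩
  · exact (hWI (mk_mem_prod (mem_of_mem_nhds hW) (hI'I ht))).1
  · exact (hWI (mk_mem_prod (hW'W hy) (hI'I ht))).2

/-! ### Parametrizations in space-time and derivatives in charts. -/

namespace Frame

variable (F : Frame) (h : E2 × ℝ → ℝ)

/-- The parametrization of a moving graph. -/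
def param (p : E2 × ℝ) : E3 := F.ι p.1 + h p • F.e

/-- The parametrization of a moving graph as a set in space-time. -/
def paramTime (p : E2 × ℝ) : E3 × ℝ := (F.param h p, p.2)

/-- The derivative of `param` when the height has the derivative `ℓ`. -/
def paramDeriv (ℓ : E2 × ℝ →L[ℝ] ℝ) : E2 × ℝ →L[ℝ] E3 :=
  F.ι.comp (ContinuousLinearMap.fst ℝ E2 ℝ) + ℓ.smulRight F.e

theorem paramDeriv_apply (ℓ : E2 × ℝ →L[ℝ] ℝ) (z : E2 × ℝ) :
    F.paramDeriv ℓ z = F.ι z.1 + ℓ z • F.e := rfl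

theorem param_eq_graph (x : E2) (t : ℝ) : F.param h (x, t) = F.graph (fun x => h (x, t)) x := rfl

@[simp] theorem π_param (p : E2 × ℝ) : F.π (F.param h p) = p.1 := by simp [param]

@[simp] theorem inner_e_param (p : E2 × ℝ) : ⟪F.e, F.param h p⟫ = h p := by
  simp [param, inner_add_right, inner_smul_right, inner_e_ι]

variable {h}

theorem contDiff_param {n : WithTop ℕ∞} (hh : ContDiff ℝ n h) : ContDiff ℝ n (F.param h) := by
  unfold param; fun_prop

theorem contDiff_paramTime {n : WithTop ℕ∞} (hh : ContDiff ℝ n h) :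
    ContDiff ℝ n (F.paramTime h) :=
  (F.contDiff_param hh).prodMk contDiff_snd

theorem hasFDerivAt_param {ℓ : E2 × ℝ →L[ℝ] ℝ} {p : E2 × ℝ} (hh : HasFDerivAt h ℓ p) :
    HasFDerivAt (F.param h) (F.paramDeriv ℓ) p :=
  (F.ι.hasFDerivAt.comp p hasFDerivAt_fst).add (hh.smul_const F.e)

theorem hasFDerivAt_paramTime {ℓ : E2 × ℝ →L[ℝ] ℝ} {p : E2 × ℝ} (hh : HasFDerivAt h ℓ p) :
    HasFDerivAt (F.paramTime h) ((F.paramDeriv ℓ).prod (ContinuousLinearMap.snd ℝ E2 ℝ)) p :=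
  (F.hasFDerivAt_param hh).prodMk hasFDerivAt_snd

theorem hasFDerivAt_param_slice {ℓ : E2 × ℝ →L[ℝ] ℝ} {x : E2} {t : ℝ}
    (hh : HasFDerivAt h ℓ (x, t)) :
    HasFDerivAt (fun x => F.param h (x, t))
      ((F.paramDeriv ℓ).comp (ContinuousLinearMap.inl ℝ E2 ℝ)) x :=
  HasFDerivAt.comp (g := F.param h) (f := fun x : E2 => (x, t)) x (F.hasFDerivAt_param hh)
    (hasFDerivAt_prodMk_left x t)

end Frame

/-- The parameters that a chart maps into its domain. -/
def chartDomain (F : Frame) (h : E2 × ℝ → ℝ) (W : Set E3) (I : Set ℝ) : Set (E2 × ℝ) :=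
  {p | p.2 ∈ I ∧ F.param h p ∈ W}

/-- The tangential projection of the `i`-th standard basis vector. -/
def tanVec (n : E3 → E3) (i : Fin 3) (y : E3) : E3 :=
  ∑ j, tanProj n y i j • EuclideanSpace.single j (1 : ℝ)

theorem tanVec_eq (n : E3 → E3) (i : Fin 3) (y : E3) :
    tanVec n i y = EuclideanSpace.single i (1 : ℝ) - n y i • n y := by
  ext k
  fin_cases i <;> fin_cases k <;> simp [tanVec, tanProj, Fin.sum_univ_three]

theorem E3.inner_eq (a b : E3) : ⟪a, b⟫ = ∑ i, a i * b i := by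
  simp [EuclideanSpace.inner_eq_star_dotProduct, dotProduct, mul_comm]

theorem inner_tanVec {n : E3 → E3} {y : E3} (i : Fin 3) (a : E3) :
    ⟪tanVec n i y, a⟫ = a i - n y i * ⟪n y, a⟫ := by
  rw [tanVec_eq, inner_sub_left, inner_smul_left, EuclideanSpace.inner_single_left]
  simp

theorem inner_tanVec_normal {n : E3 → E3} {y : E3} (hn : ‖n y‖ = 1) (i : Fin 3) :
    ⟪tanVec n i y, n y⟫ = 0 := by
  rw [inner_tanVec, real_inner_self_eq_norm_sq, hn]; ring

theorem tanDeriv_def (S : Set E3) (n : E3 → E3) (i : Fin 3) (f : E3 → ℝ) (y : E3) :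
    tanDeriv S n i f y = fderivWithin ℝ f S y (tanVec n i y) := rfl

namespace IsChart

variable {T : ℝ} {Γ : ℝ → Set E3} {F : Frame} {h : E2 × ℝ → ℝ} {W : Set E3} {I : Set ℝ}
  {ν : E3 × ℝ → E3} {V : E3 × ℝ → ℝ}

theorem hasFDerivAt (hc : IsChart T Γ F h W I) (p : E2 × ℝ) : HasFDerivAt h (fderiv ℝ h p) p :=
  (hc.contDiff.differentiable (by simp) p).hasFDerivAt

theorem isOpen_chartDomain (hc : IsChart T Γ F h W I) : IsOpen (chartDomain F h W I) :=
  (hc.isOpen_time.preimage continuous_snd).inter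
    (hc.isOpen_space.preimage (F.contDiff_param hc.contDiff).continuous)

theorem isOpen_chartDomain_slice (hc : IsChart T Γ F h W I) (t : ℝ) :
    IsOpen {x : E2 | (x, t) ∈ chartDomain F h W I} :=
  hc.isOpen_chartDomain.preimage (by fun_prop : Continuous fun x : E2 => (x, t))

theorem param_mem (hc : IsChart T Γ F h W I) {p : E2 × ℝ} (hp : p ∈ chartDomain F h W I) :
    F.param h p ∈ Γ p.2 := by
  rw [hc.mem_iff _ hp.1 _ hp.2]; simp

theorem paramTime_mem (hc : IsChart T Γ F h W I) {p : E2 × ℝ} (hp : p ∈ chartDomain F h W I) :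
    F.paramTime h p ∈ spaceTime T Γ :=
  ⟨hc.time_subset hp.1, hc.param_mem hp⟩

theorem param_π (hc : IsChart T Γ F h W I) {t : ℝ} (ht : t ∈ I) {y : E3} (hyW : y ∈ W)
    (hy : y ∈ Γ t) : F.param h (F.π y, t) = y := by
  rw [hc.mem_iff t ht y hyW] at hy
  rw [Frame.param, ← hy]; exact F.split y

theorem π_mem (hc : IsChart T Γ F h W I) {t : ℝ} (ht : t ∈ I) {y : E3} (hyW : y ∈ W)
    (hy : y ∈ Γ t) : (F.π y, t) ∈ chartDomain F h W I :=
  ⟨ht, by rwa [hc.param_π ht hyW hy]⟩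

/-- The defining property of the normal is tested on the image of a straight line in the parameter
plane. -/
theorem inner_normal_of_space (hc : IsChart T Γ F h W I) (hν : IsUnitOutwardNormal T Γ ν)
    {p : E2 × ℝ} (hp : p ∈ chartDomain F h W I) (a : E2) :
    ⟪F.paramDeriv (fderiv ℝ h p) (a, 0), ν (F.paramTime h p)⟫ = 0 := by
  have hline : HasDerivAt (fun s : ℝ => (p.1 + s • a, p.2)) (a, (0 : ℝ)) 0 := by
    have h1 : HasDerivAt (fun s : ℝ => p.1 + s • a) a 0 := by
      simpa using ((hasDerivAt_id (0 : ℝ)).smul_const a).const_add p.1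
    exact h1.prodMk (hasDerivAt_const _ _)
  refine hν.normal _ (hc.paramTime_mem hp) (fun s => F.param h (p.1 + s • a, p.2)) _ ?_ ?_ ?_
  · have h2 : HasFDerivAt (F.param h) (F.paramDeriv (fderiv ℝ h p)) (p.1 + (0 : ℝ) • a, p.2) := by
      simpa using F.hasFDerivAt_param (hc.hasFDerivAt p)
    exact h2.comp_hasDerivAt (0 : ℝ) hline
  · simp [Frame.paramTime]
  · have h4 := hline.continuousAt.preimage_mem_nhds
      (hc.isOpen_chartDomain.mem_nhds (by simpa using hp))
    filter_upwards [h4] with s hs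
    exact hc.param_mem hs

/-- The point with fixed plane coordinates moves with the surface, so it is an admissible test curve
for the normal velocity. -/
theorem inner_normal_of_time (hc : IsChart T Γ F h W I) (hV : IsNormalVelocity T Γ ν V)
    {p : E2 × ℝ} (hp : p ∈ chartDomain F h W I) :
    ⟪F.paramDeriv (fderiv ℝ h p) (0, 1), ν (F.paramTime h p)⟫ = V (F.paramTime h p) := by
  have hline : HasDerivAt (fun s : ℝ => (p.1, s)) ((0 : E2), (1 : ℝ)) p.2 :=
    (hasDerivAt_const _ _).prodMk (hasDerivAt_id _)
  refine hV _ (hc.paramTime_mem hp) (fun s => F.param h (p.1, s)) _ ?_ rfl ?_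
  · exact (F.hasFDerivAt_param (hc.hasFDerivAt (p.1, p.2))).comp_hasDerivAt p.2 hline
  · filter_upwards [hline.continuousAt.preimage_mem_nhds (hc.isOpen_chartDomain.mem_nhds hp)]
      with s hs
    exact hc.param_mem hs

/-- The plane part of the normal is determined by its component along `e`. -/
theorem inner_normal_ι (hc : IsChart T Γ F h W I) (hν : IsUnitOutwardNormal T Γ ν)
    {p : E2 × ℝ} (hp : p ∈ chartDomain F h W I) (a : E2) :
    ⟪ν (F.paramTime h p), F.ι a⟫ = -(fderiv ℝ h p (a, 0) * ⟪F.e, ν (F.paramTime h p)⟫) := by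
  have h1 := hc.inner_normal_of_space hν hp a
  rw [F.paramDeriv_apply, inner_add_left, inner_smul_left] at h1
  rw [real_inner_comm]
  simp at h1
  linarith

/-- Pythagoras for the unit normal, whose plane part is `-⟪e, ν⟫ ∇h`. In particular `⟪e, ν⟫` never
vanishes. -/
theorem inner_e_normal_sq (hc : IsChart T Γ F h W I) (hν : IsUnitOutwardNormal T Γ ν)
    {p : E2 × ℝ} (hp : p ∈ chartDomain F h W I) :
    ⟪F.e, ν (F.paramTime h p)⟫ ^ 2 *
      areaDensity ((fderiv ℝ h p).comp (ContinuousLinearMap.inl ℝ E2 ℝ)) ^ 2 = 1 := by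
  have hn := hν.unit _ (hc.paramTime_mem hp)
  set n := ν (F.paramTime h p) with hndef
  have h1 : ‖n‖ ^ 2 = ‖F.π n‖ ^ 2 + ⟪F.e, n⟫ ^ 2 := by
    rw [← F.norm_sq_ι_add, F.split]
  have h2 : ‖F.π n‖ ^ 2 = ⟪n, F.ι (bvec 0)⟫ ^ 2 + ⟪n, F.ι (bvec 1)⟫ ^ 2 := by
    rw [← F.inner_π, ← F.inner_π, EuclideanSpace.norm_sq_eq, Fin.sum_univ_two]
    simp [EuclideanSpace.inner_single_right]
  rw [hc.inner_normal_ι hν hp, hc.inner_normal_ι hν hp, ← hndef] at h2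
  rw [areaDensity_sq]
  simp only [ContinuousLinearMap.comp_apply, ContinuousLinearMap.inl_apply]
  rw [hn] at h1
  linarith

/-- A vector with the right normal component is the velocity of a motion of the parameters. -/
theorem paramDeriv_π (hc : IsChart T Γ F h W I) (hν : IsUnitOutwardNormal T Γ ν)
    (hV : IsNormalVelocity T Γ ν V) {p : E2 × ℝ} (hp : p ∈ chartDomain F h W I) {X : E3} {σ : ℝ}
    (hX : ⟪X, ν (F.paramTime h p)⟫ = σ * V (F.paramTime h p)) :
    F.paramDeriv (fderiv ℝ h p) (F.π X, σ) = X := by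
  set ℓ := fderiv ℝ h p
  set n := ν (F.paramTime h p)
  have hz : ((F.π X, σ) : E2 × ℝ) = (F.π X, 0) + σ • ((0 : E2), (1 : ℝ)) := by simp
  have h1 : ⟪F.paramDeriv ℓ (F.π X, σ), n⟫ = ⟪X, n⟫ := by
    rw [hz, map_add, map_smul, inner_add_left, inner_smul_left, hc.inner_normal_of_space hν hp,
      hc.inner_normal_of_time hV hp, hX]
    simp
  -- Both vectors have the same plane part, so they differ by a multiple of `e`; equal normal
  -- components and `⟪e, n⟫ ≠ 0` make that multiple zero.
  have h2 : F.paramDeriv ℓ (F.π X, σ) - X = (ℓ (F.π X, σ) - ⟪F.e, X⟫) • F.e := by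
    conv_lhs => rw [← F.split X, F.paramDeriv_apply]
    rw [sub_smul]
    simp
  have h3 : (ℓ (F.π X, σ) - ⟪F.e, X⟫) * ⟪F.e, n⟫ = 0 := by
    have : ⟪F.paramDeriv ℓ (F.π X, σ) - X, n⟫ = 0 := by rw [inner_sub_left, h1, sub_self]
    rw [h2, inner_smul_left] at this
    simpa using this
  have h4 : ⟪F.e, n⟫ ≠ 0 := by
    intro h0
    have := hc.inner_e_normal_sq hν hp
    rw [h0] at this
    norm_num at this
  have h5 := (mul_eq_zero.1 h3).resolve_right h4
  rw [h5, zero_smul, sub_eq_zero] at h2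
  exact h2

/-- Needed because a derivative within a hypersurface is determined only on tangent directions. -/
theorem mem_tangentConeAt_spaceTime (hc : IsChart T Γ F h W I) {p : E2 × ℝ}
    (hp : p ∈ chartDomain F h W I) (z : E2 × ℝ) :
    (F.paramDeriv (fderiv ℝ h p) z, z.2) ∈ tangentConeAt ℝ (spaceTime T Γ) (F.paramTime h p) := by
  have h1 := (F.hasFDerivAt_paramTime (hc.hasFDerivAt p)).hasFDerivWithinAt
    (s := chartDomain F h W I)
  have h2 := h1.mapsTo_tangent_cone (show z ∈ _ by
    rw [tangentConeAt_of_mem_nhds (hc.isOpen_chartDomain.mem_nhds hp)]; trivial)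
  refine tangentConeAt_mono ?_ h2
  rintro _ ⟨p', hp', rfl⟩
  exact hc.paramTime_mem hp'

theorem mem_tangentConeAt_surface (hc : IsChart T Γ F h W I) {x : E2} {t : ℝ}
    (hp : (x, t) ∈ chartDomain F h W I) (a : E2) :
    F.paramDeriv (fderiv ℝ h (x, t)) (a, 0) ∈ tangentConeAt ℝ (Γ t) (F.param h (x, t)) := by
  have h1 := (F.hasFDerivAt_param_slice (hc.hasFDerivAt (x, t))).hasFDerivWithinAt
    (s := {x : E2 | (x, t) ∈ chartDomain F h W I})
  have h2 := h1.mapsTo_tangent_cone (show a ∈ _ by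
    rw [tangentConeAt_of_mem_nhds ((hc.isOpen_chartDomain_slice t).mem_nhds hp)]; trivial)
  refine tangentConeAt_mono ?_ h2
  rintro _ ⟨p', hp', rfl⟩
  exact hc.param_mem hp'

variable {G : Type*} [NormedAddCommGroup G] [NormedSpace ℝ G]

/-- The chain rule: by `paramDeriv_π` the direction `(X, σ)` is the image of the parameter direction
`(π X, σ)`. Taking `σ = 1` covers material derivatives. -/
theorem fderivWithin_spaceTime (hc : IsChart T Γ F h W I) (hν : IsUnitOutwardNormal T Γ ν)
    (hV : IsNormalVelocity T Γ ν V) {p : E2 × ℝ} (hp : p ∈ chartDomain F h W I) {X : E3} {σ : ℝ}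
    (hX : ⟪X, ν (F.paramTime h p)⟫ = σ * V (F.paramTime h p)) {f : E3 × ℝ → G}
    (hf : DifferentiableWithinAt ℝ f (spaceTime T Γ) (F.paramTime h p)) :
    fderivWithin ℝ f (spaceTime T Γ) (F.paramTime h p) (X, σ) =
      fderiv ℝ (fun z => f (F.paramTime h z)) p (F.π X, σ) := by
  have hev : ∀ᶠ z in 𝓝 p, F.paramTime h z ∈ spaceTime T Γ := by
    filter_upwards [hc.isOpen_chartDomain.mem_nhds hp] with z hz using hc.paramTime_mem hz
  have h1 := hf.hasFDerivWithinAt.comp_hasFDerivAt p (F.hasFDerivAt_paramTime (hc.hasFDerivAt p)) hev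
  have h2 := h1.fderiv
  simp only [Function.comp_def] at h2
  rw [h2]
  simp [hc.paramDeriv_π hν hV hp hX]

theorem fderivWithin_surface (hc : IsChart T Γ F h W I) (hν : IsUnitOutwardNormal T Γ ν)
    (hV : IsNormalVelocity T Γ ν V) {x : E2} {t : ℝ} (hp : (x, t) ∈ chartDomain F h W I) {X : E3}
    (hX : ⟪X, ν (F.param h (x, t), t)⟫ = 0) {f : E3 → G}
    (hf : DifferentiableWithinAt ℝ f (Γ t) (F.param h (x, t))) :
    fderivWithin ℝ f (Γ t) (F.param h (x, t)) X =
      fderiv ℝ (fun x => f (F.param h (x, t))) x (F.π X) := by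
  have hev : ∀ᶠ x' in 𝓝 x, F.param h (x', t) ∈ Γ t := by
    filter_upwards [(hc.isOpen_chartDomain_slice t).mem_nhds hp] with x' hx' using hc.param_mem hx'
  have h1 := hf.hasFDerivWithinAt.comp_hasFDerivAt x
    (F.hasFDerivAt_param_slice (hc.hasFDerivAt (x, t))) hev
  have h2 := h1.fderiv
  simp only [Function.comp_def] at h2
  rw [h2]
  simp [hc.paramDeriv_π hν hV hp (X := X) (σ := 0) (by rw [zero_mul]; exact hX)]

end IsChart

/-! ### The area density of a moving graph and its derivative. -/

/-- The area density of a moving graph. -/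
def jac (h : E2 × ℝ → ℝ) (p : E2 × ℝ) : ℝ :=
  areaDensity ((fderiv ℝ h p).comp (ContinuousLinearMap.inl ℝ E2 ℝ))

theorem jac_pos (h : E2 × ℝ → ℝ) (p : E2 × ℝ) : 0 < jac h p := areaDensity_pos _

theorem jac_sq (h : E2 × ℝ → ℝ) (p : E2 × ℝ) :
    jac h p ^ 2 = 1 + fderiv ℝ h p (bvec 0, 0) ^ 2 + fderiv ℝ h p (bvec 1, 0) ^ 2 :=
  areaDensity_sq _

theorem jac_eq_slice {h : E2 × ℝ → ℝ} {x : E2} {t : ℝ} (hh : DifferentiableAt ℝ h (x, t)) :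
    areaDensity (fderiv ℝ (fun x => h (x, t)) x) = jac h (x, t) := by
  have : HasFDerivAt (fun x => h (x, t))
      ((fderiv ℝ h (x, t)).comp (ContinuousLinearMap.inl ℝ E2 ℝ)) x :=
    HasFDerivAt.comp (g := h) (f := fun x : E2 => (x, t)) x hh.hasFDerivAt
      (hasFDerivAt_prodMk_left x t)
  rw [this.fderiv, jac]

theorem contDiff_jac {h : E2 × ℝ → ℝ} (hh : ContDiff ℝ 2 h) : ContDiff ℝ 1 (jac h) := by
  have h1 : ContDiff ℝ 1 (fderiv ℝ h) := hh.fderiv_right (by norm_num)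
  unfold jac areaDensity
  refine ContDiff.sqrt ?_ fun p => by positivity
  simp only [ContinuousLinearMap.comp_apply]
  fun_prop

/-- Half the derivative of `jac²`, with the two directions of the second derivative exchanged by
symmetry. -/
theorem jac_mul_fderiv_jac {h : E2 × ℝ → ℝ} (hh : ContDiff ℝ 2 h) (p z : E2 × ℝ) :
    jac h p * fderiv ℝ (jac h) p z =
      fderiv ℝ h p (bvec 0, 0) * fderiv ℝ (fderiv ℝ h) p (bvec 0, 0) z +
      fderiv ℝ h p (bvec 1, 0) * fderiv ℝ (fderiv ℝ h) p (bvec 1, 0) z := by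
  have h1 : ContDiff ℝ 1 (fderiv ℝ h) := hh.fderiv_right (by norm_num)
  have h2 : HasFDerivAt (fderiv ℝ h) (fderiv ℝ (fderiv ℝ h) p) p :=
    (h1.differentiable (by simp) p).hasFDerivAt
  have h3 : HasFDerivAt (jac h) (fderiv ℝ (jac h) p) p :=
    ((contDiff_jac hh).differentiable (by simp) p).hasFDerivAt
  have hsymm : ∀ u, fderiv ℝ (fderiv ℝ h) p z u = fderiv ℝ (fderiv ℝ h) p u z := fun u =>
    (hh.contDiffAt.isSymmSndFDerivAt (by simp)) z u
  have hcomp : ∀ u : E2 × ℝ, HasFDerivAt (fun q => fderiv ℝ h q u)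
      ((fderiv ℝ (fderiv ℝ h) p).flip u) p := fun u => by
    simpa using h2.clm_apply (hasFDerivAt_const u p)
  have hL := h3.pow 2
  have hR := (((hcomp (bvec 0, 0)).pow 2).const_add 1).add ((hcomp (bvec 1, 0)).pow 2)
  have hfun : (fun q => jac h q ^ 2) = (fun q => 1 + fderiv ℝ h q (bvec 0, 0) ^ 2) +
      fun q => fderiv ℝ h q (bvec 1, 0) ^ 2 := funext (jac_sq h)
  rw [hfun] at hL
  have huniq := congrArg (fun L => L z) (hL.unique hR)
  simp [hsymm] at huniq
  linarith

/-! ### Well-definedness and regularity of tangential and material derivatives. -/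

/-- Smoothness of a moving surface together with the properties of its unit normal field and of its
normal velocity. -/
structure IsEvolution (T : ℝ) (Γ : ℝ → Set E3) (ν : E3 × ℝ → E3) (V : E3 × ℝ → ℝ) : Prop where
  surface : IsMovingClosedSurface T Γ
  normal : IsUnitOutwardNormal T Γ ν
  velocity : IsNormalVelocity T Γ ν V

section Evolution

variable {T : ℝ} {Γ : ℝ → Set E3} {ν : E3 × ℝ → E3} {V : E3 × ℝ → ℝ}
  {G : Type} [NormedAddCommGroup G] [NormedSpace ℝ G]

/-- The inclusion of a surface at a fixed time into space-time preserves smoothness. -/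
theorem contDiffOn_slice {f : E3 × ℝ → G} {n : WithTop ℕ∞} (hf : ContDiffOn ℝ n f (spaceTime T Γ))
    {t : ℝ} (ht : t ∈ Ioo 0 T) : ContDiffOn ℝ n (slice f t) (Γ t) :=
  hf.comp (f := fun y : E3 => (y, t)) (by fun_prop) fun _ hy => ⟨ht, hy⟩

namespace IsEvolution

/-- Tangent vectors lie in the tangent cone, where all derivatives within the surface agree. This is
what makes the sum and product rules available for tangential derivatives. -/
theorem fderivWithin_surface_eq (hE : IsEvolution T Γ ν V) {t : ℝ} (ht : t ∈ Ioo 0 T) {y : E3}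
    (hy : y ∈ Γ t) {τ : E3} (hτ : ⟪τ, ν (y, t)⟫ = 0) {f : E3 → G} {f' : E3 →L[ℝ] G}
    (hf : HasFDerivWithinAt f f' (Γ t) y) : fderivWithin ℝ f (Γ t) y τ = f' τ := by
  obtain ⟨F, h, W, I, hc, hyW, htI⟩ := exists_isChart hE.surface ht hy
  have hp := hc.π_mem htI hyW hy
  have hpar := hc.param_π htI hyW hy
  have h1 := hc.mem_tangentConeAt_surface hp (F.π τ)
  rw [hc.paramDeriv_π hE.normal hE.velocity hp (by rw [Frame.paramTime, hpar, hτ, zero_mul]),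
    hpar] at h1
  exact (hf.differentiableWithinAt.hasFDerivWithinAt.unique_on hf) h1

theorem fderivWithin_spaceTime_eq (hE : IsEvolution T Γ ν V) {t : ℝ} (ht : t ∈ Ioo 0 T) {y : E3}
    (hy : y ∈ Γ t) {X : E3} (hX : ⟪X, ν (y, t)⟫ = V (y, t)) {f : E3 × ℝ → G}
    {f' : E3 × ℝ →L[ℝ] G} (hf : HasFDerivWithinAt f f' (spaceTime T Γ) (y, t)) :
    fderivWithin ℝ f (spaceTime T Γ) (y, t) (X, 1) = f' (X, 1) := by
  obtain ⟨F, h, W, I, hc, hyW, htI⟩ := exists_isChart hE.surface ht hy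
  have hp := hc.π_mem htI hyW hy
  have hpar := hc.param_π htI hyW hy
  have h1 := hc.mem_tangentConeAt_spaceTime hp (F.π X, 1)
  rw [hc.paramDeriv_π hE.normal hE.velocity hp (by rw [Frame.paramTime, hpar, hX, one_mul]),
    Frame.paramTime, hpar] at h1
  exact (hf.differentiableWithinAt.hasFDerivWithinAt.unique_on hf) h1

end IsEvolution

namespace IsChart

variable {F : Frame} {h : E2 × ℝ → ℝ} {W : Set E3} {I : Set ℝ}

theorem contDiffOn_comp_paramTime (hc : IsChart T Γ F h W I) {f : E3 × ℝ → G} {n : WithTop ℕ∞}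
    (hn : n ≤ 2) (hf : ContDiffOn ℝ n f (spaceTime T Γ)) :
    ContDiffOn ℝ n (fun p => f (F.paramTime h p)) (chartDomain F h W I) :=
  hf.comp ((F.contDiff_paramTime hc.contDiff).of_le hn).contDiffOn fun _ hp => hc.paramTime_mem hp

theorem contDiffOn_comp_param (hc : IsChart T Γ F h W I) {t : ℝ} {f : E3 → G} {n : WithTop ℕ∞}
    (hn : n ≤ 2) (hf : ContDiffOn ℝ n f (Γ t)) :
    ContDiffOn ℝ n (fun x => f (F.param h (x, t))) {x | (x, t) ∈ chartDomain F h W I} :=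
  hf.comp (f := fun x => F.param h (x, t))
    (((F.contDiff_param hc.contDiff).of_le hn).comp (contDiff_prodMk_left t)).contDiffOn
    fun _ hp => hc.param_mem hp

end IsChart

namespace IsEvolution

/-- A tangential derivative of a `C^(n+1)` function is `C^n`. -/
theorem contDiffOn_fderivWithin_surface (hE : IsEvolution T Γ ν V) {t : ℝ} (ht : t ∈ Ioo 0 T)
    {n : WithTop ℕ∞} (hn : n + 1 ≤ 2) {f : E3 → G} (hf : ContDiffOn ℝ (n + 1) f (Γ t)) {τ : E3 → E3}
    (hτ : ContDiffOn ℝ n τ (Γ t)) (hτν : ∀ y ∈ Γ t, ⟪τ y, ν (y, t)⟫ = 0) :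
    ContDiffOn ℝ n (fun y => fderivWithin ℝ f (Γ t) y (τ y)) (Γ t) := by
  intro y hy
  obtain ⟨F, h, W, I, hc, hyW, htI⟩ := exists_isChart hE.surface ht hy
  have hp := hc.π_mem htI hyW hy
  set N := {x | (x, t) ∈ chartDomain F h W I} with hN
  have hNo : IsOpen N := hc.isOpen_chartDomain_slice t
  have h1 : ContDiffOn ℝ (n + 1) (fun x => f (F.param h (x, t))) N :=
    hc.contDiffOn_comp_param hn hf
  have h2 : ContDiffAt ℝ n (fderiv ℝ fun x => f (F.param h (x, t))) (F.π y) :=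
    (h1.fderiv_of_isOpen hNo le_rfl).contDiffAt (hNo.mem_nhds hp)
  have h3 : ContDiffWithinAt ℝ n
      (fun y => fderiv ℝ (fun x => f (F.param h (x, t))) (F.π y) (F.π (τ y))) (Γ t) y := by
    refine ContDiffWithinAt.clm_apply ?_ ?_
    · exact h2.comp_contDiffWithinAt y F.π.contDiff.contDiffWithinAt
    · exact F.π.contDiff.contDiffAt.comp_contDiffWithinAt y (hτ y hy)
  have key : ∀ z ∈ Γ t, z ∈ W → fderivWithin ℝ f (Γ t) z (τ z) =
      fderiv ℝ (fun x => f (F.param h (x, t))) (F.π z) (F.π (τ z)) := by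
    intro z hz hzW
    have hpar := hc.param_π htI hzW hz
    have := hc.fderivWithin_surface hE.normal hE.velocity (hc.π_mem htI hzW hz) (X := τ z)
      (by rw [hpar]; exact hτν z hz) (f := f)
      (by rw [hpar]; exact (hf z hz).differentiableWithinAt (by simp))
    rwa [hpar] at this
  refine h3.congr_of_eventuallyEq ?_ (key y hy hyW)
  filter_upwards [self_mem_nhdsWithin, mem_nhdsWithin_of_mem_nhds (hc.isOpen_space.mem_nhds hyW)]
    with z hz hzW using key z hz hzW

theorem continuousOn_fderivWithin_spaceTime (hE : IsEvolution T Γ ν V) {t : ℝ} (ht : t ∈ Ioo 0 T)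
    {f : E3 × ℝ → G} (hf : ContDiffOn ℝ 1 f (spaceTime T Γ)) {w : E3 → E3}
    (hw : ContinuousOn w (Γ t)) (hwV : ∀ y ∈ Γ t, ⟪w y, ν (y, t)⟫ = V (y, t)) :
    ContinuousOn (fun y => fderivWithin ℝ f (spaceTime T Γ) (y, t) (w y, 1)) (Γ t) := by
  intro y hy
  obtain ⟨F, h, W, I, hc, hyW, htI⟩ := exists_isChart hE.surface ht hy
  have hp := hc.π_mem htI hyW hy
  have h1 := hc.contDiffOn_comp_paramTime one_le_two hf
  have h2 : ContinuousAt (fderiv ℝ fun p => f (F.paramTime h p)) (F.π y, t) :=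
    (h1.continuousOn_fderiv_of_isOpen hc.isOpen_chartDomain le_rfl).continuousAt
      (hc.isOpen_chartDomain.mem_nhds hp)
  have h3 : ContinuousWithinAt
      (fun y => fderiv ℝ (fun p => f (F.paramTime h p)) (F.π y, t) (F.π (w y), 1)) (Γ t) y := by
    refine ContinuousWithinAt.clm_apply ?_ ?_
    · exact h2.comp_continuousWithinAt (f := fun y => (F.π y, t)) (by fun_prop)
    · exact (F.π.continuous.continuousAt.comp_continuousWithinAt (hw y hy)).prodMk
        continuousWithinAt_const
  have key : ∀ z ∈ Γ t, z ∈ W → fderivWithin ℝ f (spaceTime T Γ) (z, t) (w z, 1) =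
      fderiv ℝ (fun p => f (F.paramTime h p)) (F.π z, t) (F.π (w z), 1) := by
    intro z hz hzW
    have hpar := hc.param_π htI hzW hz
    have := hc.fderivWithin_spaceTime hE.normal hE.velocity (hc.π_mem htI hzW hz) (X := w z)
      (σ := 1) (by rw [Frame.paramTime, hpar, one_mul]; exact hwV z hz) (f := f)
      (by rw [Frame.paramTime, hpar]
          exact (hf (z, t) ⟨ht, hz⟩).differentiableWithinAt (by simp))
    rwa [Frame.paramTime, hpar] at this
  refine h3.congr_of_eventuallyEq ?_ (key y hy hyW)
  filter_upwards [self_mem_nhdsWithin, mem_nhdsWithin_of_mem_nhds (hc.isOpen_space.mem_nhds hyW)]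
    with z hz hzW using key z hz hzW

end IsEvolution

/-! ### The surface divergence in a chart. -/

theorem differentiableWithinAt_apply {S : Set E3} {w : E3 → E3} {y : E3}
    (hw : DifferentiableWithinAt ℝ w S y) (i : Fin 3) :
    DifferentiableWithinAt ℝ (fun x => w x i) S y :=
  (EuclideanSpace.proj i : E3 →L[ℝ] ℝ).hasFDerivAt.comp_hasFDerivWithinAt y
    hw.hasFDerivWithinAt |>.differentiableWithinAt

/-- The coordinates of `π (P eᵢ)` are the `i`-th components of `P (ι b_α)`, so the sum over `i`
collapses to `∑_α ⟪X' b_α, P (ι b_α)⟫`. -/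
theorem Frame.surfDiv_eq_inner (F : Frame) {S : Set E3} {n w : E3 → E3} {y : E3} {X' : E2 →L[ℝ] E3}
    (h : ∀ i, tanDeriv S n i (fun y => w y i) y = X' (F.π (tanVec n i y)) i) :
    surfDiv S n w y =
      (⟪X' (bvec 0), F.ι (bvec 0)⟫ - ⟪n y, F.ι (bvec 0)⟫ * ⟪X' (bvec 0), n y⟫) +
      (⟪X' (bvec 1), F.ι (bvec 1)⟫ - ⟪n y, F.ι (bvec 1)⟫ * ⟪X' (bvec 1), n y⟫) := by
  have hcoord : ∀ (i : Fin 3) (α : Fin 2), F.π (tanVec n i y) α =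
      F.ι (bvec α) i - n y i * ⟪n y, F.ι (bvec α)⟫ := by
    intro i α
    have : F.π (tanVec n i y) α = ⟪F.π (tanVec n i y), bvec α⟫ := by
      simp [EuclideanSpace.inner_single_right]
    rw [this, F.inner_π, inner_tanVec]
  unfold surfDiv
  simp only [h, clm_apply_eq_sum X' (F.π _), hcoord]
  generalize ⟪n y, F.ι (bvec 0)⟫ = α
  generalize ⟪n y, F.ι (bvec 1)⟫ = β
  simp only [E3.inner_eq, Fin.sum_univ_three, PiLp.add_apply, PiLp.smul_apply, smul_eq_mul]
  ring

set_option maxHeartbeats 1000000 in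
/-- The divergence of a velocity field of the moving surface in a chart. -/
theorem IsChart.surfDiv_eq {F : Frame} {h : E2 × ℝ → ℝ} {W : Set E3} {I : Set ℝ}
    (hc : IsChart T Γ F h W I) (hE : IsEvolution T Γ ν V) {x : E2} {t : ℝ}
    (hp : (x, t) ∈ chartDomain F h W I) {w : E3 → E3} (hw : DifferentiableOn ℝ w (Γ t))
    (hwV : ∀ y ∈ Γ t, ⟪w y, ν (y, t)⟫ = V (y, t)) {w' : E2 →L[ℝ] E2}
    (hw' : HasFDerivAt (fun x => F.π (w (F.param h (x, t)))) w' x) :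
    surfDiv (Γ t) (slice ν t) w (F.param h (x, t)) =
      w' (bvec 0) 0 + w' (bvec 1) 1 +
        fderiv ℝ (jac h) (x, t) (F.π (w (F.param h (x, t))), 1) / jac h (x, t) := by
  have ht := hc.time_subset hp.1
  have hy := hc.param_mem hp
  set y := F.param h (x, t) with hydef
  set n : E3 := ν (y, t) with hn
  have hnu : ‖n‖ = 1 := hE.normal.unit (y, t) ⟨ht, hy⟩
  set X : E2 → E3 := fun x => w (F.param h (x, t)) with hX
  set wt : E2 → E2 := fun x => F.π (X x) with hwt
  have hXV : ∀ x', (x', t) ∈ chartDomain F h W I → ⟪X x', ν (F.paramTime h (x', t))⟫ =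
      1 * V (F.paramTime h (x', t)) := fun x' hx' => by
    rw [one_mul]; exact hwV _ (hc.param_mem hx')
  -- The height component of an admissible velocity is forced by its plane part. Differentiating
  -- this formula expresses `X'` through `w'` and the Hessian of `h`.
  have hXeq : ∀ x', (x', t) ∈ chartDomain F h W I →
      X x' = F.ι (wt x') + fderiv ℝ h (x', t) (wt x', 1) • F.e := fun x' hx' =>
    (hc.paramDeriv_π hE.normal hE.velocity hx' (hXV x' hx')).symm
  set ℓ := fderiv ℝ h (x, t) with hℓ
  set H := fderiv ℝ (fderiv ℝ h) (x, t) with hH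
  have hHd : HasFDerivAt (fderiv ℝ h) H (x, t) :=
    ((hc.contDiff.fderiv_right (m := 1) (by norm_num)).differentiable (by simp) _).hasFDerivAt
  have hHd' : HasFDerivAt (fun x' : E2 => fderiv ℝ h (x', t))
      (H.comp (ContinuousLinearMap.inl ℝ E2 ℝ)) x :=
    HasFDerivAt.comp (g := fderiv ℝ h) (f := fun x : E2 => (x, t)) x hHd
      (hasFDerivAt_prodMk_left x t)
  have hwt' : HasFDerivAt wt w' x := hw'
  obtain ⟨X', hX'd, hX'⟩ : ∃ X' : E2 →L[ℝ] E3, HasFDerivAt X X' x ∧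
      ∀ b, X' b = F.ι (w' b) + (H (b, 0) (wt x, 1) + ℓ (w' b, 0)) • F.e := by
    have h1 := (F.ι.hasFDerivAt.comp x hwt').add
      ((hHd'.clm_apply (hwt'.prodMk (hasFDerivAt_const (1 : ℝ) x))).smul_const F.e)
    refine ⟨_, h1.congr_of_eventuallyEq ?_, fun b => ?_⟩
    · filter_upwards [(hc.isOpen_chartDomain_slice t).mem_nhds hp] with x' hx' using hXeq x' hx'
    · simp [← hℓ, add_comm]
  have hcomp : ∀ i : Fin 3, tanDeriv (Γ t) (slice ν t) i (fun y => w y i) y =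
      X' (F.π (tanVec (slice ν t) i y)) i := by
    intro i
    have h1 := hc.fderivWithin_surface hE.normal hE.velocity hp
      (inner_tanVec_normal (n := slice ν t) hnu i) (differentiableWithinAt_apply (hw y hy) i)
    have h2 : HasFDerivAt (fun x => w (F.param h (x, t)) i)
        ((EuclideanSpace.proj i : E3 →L[ℝ] ℝ).comp X') x :=
      (EuclideanSpace.proj i : E3 →L[ℝ] ℝ).hasFDerivAt.comp x hX'd
    rw [h2.fderiv] at h1
    exact h1
  have hsum := F.surfDiv_eq_inner hcomp
  rw [show slice ν t y = n from rfl] at hsum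
  have hnι : ∀ b, ⟪n, F.ι b⟫ = -(ℓ (b, 0) * ⟪F.e, n⟫) := hc.inner_normal_ι hE.normal hp
  have hc2 : ⟪F.e, n⟫ ^ 2 * jac h (x, t) ^ 2 = 1 := hc.inner_e_normal_sq hE.normal hp
  have hA : ∀ b, ⟪X' b, F.ι b⟫ = ⟪w' b, b⟫ := by
    intro b
    rw [hX', inner_add_left, F.inner_ι, real_inner_smul_left, F.inner_e_ι, mul_zero, add_zero]
  have hB : ∀ b, ⟪X' b, n⟫ = H (b, 0) (wt x, 1) * ⟪F.e, n⟫ := by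
    intro b
    rw [hX', inner_add_left, real_inner_smul_left, real_inner_comm, hnι]
    ring
  have hJ := jac_mul_fderiv_jac hc.contDiff (x, t) (wt x, 1)
  rw [← hℓ, ← hH] at hJ
  have hJ0 := jac_pos h (x, t)
  rw [hsum, hA, hA, hB, hB, hnι, hnι]
  have e0 : ⟪w' (bvec 0), bvec 0⟫ = w' (bvec 0) 0 := by simp [EuclideanSpace.inner_single_right]
  have e1 : ⟪w' (bvec 1), bvec 1⟫ = w' (bvec 1) 1 := by simp [EuclideanSpace.inner_single_right]
  rw [e0, e1]
  -- The Hessian terms carry the factor `⟪e, n⟫² = 1 / jac²`; this rewrites the logarithmic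
  -- derivative of `jac` in the same form.
  have hdiv : fderiv ℝ (jac h) (x, t) (wt x, 1) / jac h (x, t) =
      ⟪F.e, n⟫ ^ 2 * (jac h (x, t) * fderiv ℝ (jac h) (x, t) (wt x, 1)) := by
    rw [div_eq_iff hJ0.ne']
    linear_combination (-fderiv ℝ (jac h) (x, t) (wt x, 1)) * hc2
  change _ = _ + fderiv ℝ (jac h) (x, t) (wt x, 1) / jac h (x, t)
  rw [hdiv, hJ]
  ring

end Evolution

/-! ### The transport theorem in a chart. -/

section

/-- Integration by parts against the constant `1`. -/
theorem integral_fderiv_apply_eq_zero {g : E2 → ℝ} (hg : ContDiff ℝ 1 g) (hc : HasCompactSupport g)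
    (v : E2) : ∫ x, fderiv ℝ g x v = 0 := by
  have h1 : Integrable fun x => fderiv ℝ g x v :=
    ((hg.continuous_fderiv one_ne_zero).clm_apply continuous_const).integrable_of_hasCompactSupport
      (hc.fderiv_apply ℝ v)
  have h2 := integral_mul_fderiv_eq_neg_fderiv_mul_of_integrable (μ := (volume : Measure E2))
    (f := fun _ => (1 : ℝ)) (g := g) (v := v) (by simp) (by simpa using h1)
    (by simpa using hg.continuous.integrable_of_hasCompactSupport hc)
    (fun _ _ => differentiableAt_const _) fun x _ => hg.differentiable (by simp) x
  simpa using h2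

/-- The integral over the plane of the divergence of a compactly supported field vanishes. -/
theorem integral_div_eq_zero {Z : E2 → E2} (hZ : ContDiff ℝ 1 Z) (hc : HasCompactSupport Z) :
    Integrable (fun x => fderiv ℝ Z x (bvec 0) 0 + fderiv ℝ Z x (bvec 1) 1) ∧
      ∫ x, (fderiv ℝ Z x (bvec 0) 0 + fderiv ℝ Z x (bvec 1) 1) = 0 := by
  have hcomp : ∀ α : Fin 2, ContDiff ℝ 1 fun x => Z x α := fun α =>
    (EuclideanSpace.proj α : E2 →L[ℝ] ℝ).contDiff.comp hZ
  have hsupp : ∀ α : Fin 2, HasCompactSupport fun x => Z x α := fun α =>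
    hc.comp_left (g := fun z : E2 => z α) rfl
  have hd : ∀ (α : Fin 2) (x v : E2), fderiv ℝ Z x v α = fderiv ℝ (fun x => Z x α) x v := by
    intro α x v
    have := (EuclideanSpace.proj α : E2 →L[ℝ] ℝ).hasFDerivAt.comp x
      (hZ.differentiable (by simp) x).hasFDerivAt
    have h2 := this.fderiv
    simp only [Function.comp_def] at h2
    rw [show (fun x => Z x α) = fun x => (EuclideanSpace.proj α : E2 →L[ℝ] ℝ) (Z x) from rfl, h2]
    rfl
  have hint : ∀ α : Fin 2, Integrable fun x => fderiv ℝ (fun x => Z x α) x (bvec α) := fun α =>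
    (((hcomp α).continuous_fderiv one_ne_zero).clm_apply
      continuous_const).integrable_of_hasCompactSupport ((hsupp α).fderiv_apply ℝ _)
  simp only [hd]
  refine ⟨(hint 0).add (hint 1), ?_⟩
  rw [integral_add (hint 0) (hint 1), integral_fderiv_apply_eq_zero (hcomp 0) (hsupp 0),
    integral_fderiv_apply_eq_zero (hcomp 1) (hsupp 1), add_zero]

/-- Differentiation under the integral for a `C¹` function with uniformly compact support. -/
theorem hasDerivAt_integral_of_contDiffAt {A : E2 × ℝ → ℝ} {I : Set ℝ} (hI : IsOpen I)
    (hA : ∀ p : E2 × ℝ, p.2 ∈ I → ContDiffAt ℝ 1 A p) {K : Set E2} (hK : IsCompact K)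
    (hAK : ∀ p : E2 × ℝ, p.1 ∉ K → A p = 0) {t : ℝ} (ht : t ∈ I) :
    Integrable (fun x => fderiv ℝ A (x, t) (0, 1)) ∧
    HasDerivAt (fun s => ∫ x, A (x, s)) (∫ x, fderiv ℝ A (x, t) (0, 1)) t := by
  obtain ⟨δ, hδ, hδI⟩ := Metric.nhds_basis_closedBall.mem_iff.1 (hI.mem_nhds ht)
  have hcont : ∀ s ∈ I, Continuous fun x => A (x, s) := fun s hs =>
    continuous_iff_continuousAt.2 fun x =>
      ContinuousAt.comp (f := fun x : E2 => (x, s)) (hA (x, s) hs).continuousAt (by fun_prop)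
  have hdcont : ContinuousOn (fun p => fderiv ℝ A p (0, 1)) {p | p.2 ∈ I} := by
    intro p hp
    exact (((hA p hp).fderiv_right (m := 0) (by simp)).continuousAt.clm_apply
      continuousAt_const).continuousWithinAt
  have hderiv : ∀ x, ∀ s ∈ I, HasDerivAt (fun s => A (x, s)) (fderiv ℝ A (x, s) (0, 1)) s := by
    intro x s hs
    have h1 := ((hA (x, s) hs).differentiableAt (by simp)).hasFDerivAt
    exact HasFDerivAt.comp_hasDerivAt (f := fun s => (x, s)) s h1
      ((hasDerivAt_const s x).prodMk (hasDerivAt_id s))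
  have hcpt : IsCompact (K ×ˢ Metric.closedBall t δ) := hK.prod (isCompact_closedBall t δ)
  obtain ⟨C, hC⟩ := hcpt.exists_bound_of_continuousOn
    (hdcont.mono fun p hp => hδI hp.2)
  have hzero : ∀ x, x ∉ K → ∀ s, fderiv ℝ A (x, s) (0, 1) = 0 := by
    intro x hx s
    have : A =ᶠ[𝓝 (x, s)] fun _ => 0 := by
      filter_upwards [(hK.isClosed.isOpen_compl.preimage continuous_fst).mem_nhds
        (show (x, s) ∈ Prod.fst ⁻¹' Kᶜ from hx)] with p hp using hAK p hp
    rw [this.fderiv_eq]; simp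
  have hcs : ∀ s, HasCompactSupport fun x => A (x, s) := fun s =>
    HasCompactSupport.intro hK fun x hx => hAK (x, s) hx
  refine hasDerivAt_integral_of_dominated_loc_of_deriv_le (μ := volume)
    (F := fun s x => A (x, s)) (F' := fun s x => fderiv ℝ A (x, s) (0, 1))
    (bound := K.indicator fun _ => C) (s := Metric.closedBall t δ)
    (Metric.closedBall_mem_nhds t hδ) ?_ ?_ ?_ ?_ ?_ ?_
  · filter_upwards [hI.mem_nhds ht] with s hs using (hcont s hs).aestronglyMeasurable
  · exact (hcont t ht).integrable_of_hasCompactSupport (hcs t)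
  · refine Continuous.aestronglyMeasurable ?_
    exact hdcont.comp_continuous (f := fun x : E2 => (x, t)) (by fun_prop) fun x => ht
  · refine Eventually.of_forall fun x s hs => ?_
    by_cases hx : x ∈ K
    · rw [indicator_of_mem hx]; exact hC (x, s) ⟨hx, hs⟩
    · rw [indicator_of_notMem hx, hzero x hx]; simp
  · exact (integrable_indicator_iff hK.measurableSet).2
      (integrableOn_const hK.measure_lt_top.ne)
  · exact Eventually.of_forall fun x s hs => hderiv x s (hδI hs)

variable {T : ℝ} {Γ : ℝ → Set E3} {ν : E3 × ℝ → E3} {V : E3 × ℝ → ℝ}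

theorem IsMovingClosedSurface.isCompact (hΓ : IsMovingClosedSurface T Γ) {t : ℝ}
    (ht : t ∈ Ioo 0 T) : IsCompact (Γ t) := by
  have h1 : Topology.IsClosedEmbedding (fun y : E3 => (y, t)) :=
    Topology.IsClosedEmbedding.of_continuous_injective_isClosedMap (by fun_prop)
      (fun a b hab => congrArg Prod.fst hab) (isClosedMap_prodMk_right t)
  have h2 := h1.isCompact_preimage hΓ.compact
  convert h2 using 1
  ext y
  simp [ht.1.le, ht.2.le]

namespace IsChart

variable {F : Frame} {h : E2 × ℝ → ℝ} {W : Set E3} {I : Set ℝ}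

/-- Surface and global graph coincide only inside `W`; the integrand vanishes elsewhere, so the area
formula for the whole graph applies. -/
theorem setIntegral_surface (hc : IsChart T Γ F h W I) (hΓ : IsMovingClosedSurface T Γ) {t : ℝ}
    (ht : t ∈ I) {g : E3 → ℝ} (hg : ∀ y ∉ W, g y = 0) :
    ∫ y in Γ t, g y ∂μHE[2] = ∫ x, g (F.param h (x, t)) * jac h (x, t) := by
  have hh : ContDiff ℝ 2 fun x => h (x, t) := hc.contDiff.comp (contDiff_prodMk_left t)
  have hh1 : ContDiff ℝ 1 fun x => h (x, t) := hh.of_le one_le_two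
  have h1 := F.setIntegral_graph hh1 g
  simp only [jac_eq_slice (hc.contDiff.differentiable (by simp) _)] at h1
  simp only [Frame.param_eq_graph]
  rw [← h1, ← integral_indicator (hΓ.isCompact (hc.time_subset ht)).measurableSet,
    ← integral_indicator (F.measurableEmbedding_graph hh1).measurableSet_range]
  congr 1
  funext y
  by_cases hy : y ∈ W
  · have : y ∈ Γ t ↔ y ∈ range (F.graph fun x => h (x, t)) := by
      rw [hc.mem_iff t ht y hy, F.mem_range_graph]
    by_cases hyΓ : y ∈ Γ t
    · rw [indicator_of_mem hyΓ, indicator_of_mem (this.1 hyΓ)]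
    · rw [indicator_of_notMem hyΓ, indicator_of_notMem (mt this.2 hyΓ)]
  · exact (indicator_apply_eq_zero.2 fun _ => hg y hy).trans
      (indicator_apply_eq_zero.2 fun _ => hg y hy).symm

/-- The transport theorem for a density supported in a chart. -/
theorem hasDerivAt_setIntegral (hc : IsChart T Γ F h W I) (hE : IsEvolution T Γ ν V)
    {K : Set E3} (hK : IsCompact K) (hKW : K ⊆ W) {f : E3 × ℝ → ℝ}
    (hf : ContDiffOn ℝ 1 f (spaceTime T Γ)) (hfK : ∀ p : E3 × ℝ, p.1 ∉ K → f p = 0)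
    {t : ℝ} (ht : t ∈ I) {w : E3 → E3} (hw : ContDiffOn ℝ 1 w (Γ t))
    (hwV : ∀ y ∈ Γ t, ⟪w y, ν (y, t)⟫ = V (y, t)) :
    HasDerivAt (fun s => ∫ y in Γ s, f (y, s) ∂μHE[2])
      (∫ y in Γ t, (fderivWithin ℝ f (spaceTime T Γ) (y, t) (w y, 1) +
        f (y, t) * surfDiv (Γ t) (slice ν t) w y) ∂μHE[2]) t := by
  have hΓ := hE.surface
  have hD := hc.isOpen_chartDomain
  set A : E2 × ℝ → ℝ := fun p => f (F.paramTime h p) * jac h p with hAdef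
  set wt : E2 → E2 := fun x => F.π (w (F.param h (x, t))) with hwt
  set Z : E2 → E2 := fun x => A (x, t) • wt x with hZdef
  have hparam : Continuous (F.param h) := (F.contDiff_param hc.contDiff).continuous
  have hmem : ∀ p : E2 × ℝ, p.2 ∈ I → F.param h p ∈ K → p ∈ chartDomain F h W I :=
    fun p h1 h2 => ⟨h1, hKW h2⟩
  have hE1 : ContDiffOn ℝ 1 (fun p => f (F.paramTime h p)) (chartDomain F h W I) :=
    hc.contDiffOn_comp_paramTime one_le_two hf
  have hA0 : ∀ p : E2 × ℝ, F.param h p ∉ K → A =ᶠ[𝓝 p] fun _ => 0 := by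
    intro p hp
    filter_upwards [(hK.isClosed.isOpen_compl.preimage hparam).mem_nhds hp] with q hq
    have : f (F.paramTime h q) = 0 := hfK _ hq
    simp [hAdef, this]
  have hA1 : ∀ p : E2 × ℝ, p.2 ∈ I → ContDiffAt ℝ 1 A p := by
    intro p hp
    by_cases hpK : F.param h p ∈ K
    · exact (hE1.contDiffAt (hD.mem_nhds (hmem p hp hpK))).mul (contDiff_jac hc.contDiff).contDiffAt
    · exact contDiffAt_const.congr_of_eventuallyEq (hA0 p hpK)
  have hKπ : IsCompact (F.π '' K) := hK.image F.π.continuous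
  have hAπ : ∀ p : E2 × ℝ, p.1 ∉ F.π '' K → A p = 0 := by
    intro p hp
    have : F.param h p ∉ K := fun hcon => hp ⟨_, hcon, by simp⟩
    exact (hA0 p this).self_of_nhds
  obtain ⟨hAint, hAder⟩ := hasDerivAt_integral_of_contDiffAt hc.isOpen_time hA1 hKπ hAπ ht
  have hslice : ∀ x : E2, Tendsto (fun x' : E2 => (x', t)) (𝓝 x) (𝓝 (x, t)) := fun x =>
    (by fun_prop : Continuous fun x' : E2 => (x', t)).tendsto x
  have hZ0 : ∀ x : E2, F.param h (x, t) ∉ K → Z =ᶠ[𝓝 x] fun _ => 0 := by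
    intro x hx
    filter_upwards [(hslice x).eventually (hA0 (x, t) hx)] with x' hx'
    simp [hZdef, hx']
  have hwt1 : ContDiffOn ℝ 1 wt {x | (x, t) ∈ chartDomain F h W I} :=
    F.π.contDiff.comp_contDiffOn (hc.contDiffOn_comp_param one_le_two hw)
  have hZ1 : ContDiff ℝ 1 Z := by
    refine contDiff_iff_contDiffAt.2 fun x => ?_
    by_cases hxK : F.param h (x, t) ∈ K
    · have h1 : ContDiffAt ℝ 1 (fun x : E2 => A (x, t)) x :=
        ContDiffAt.comp (f := fun x : E2 => (x, t)) x (hA1 (x, t) ht)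
          (contDiff_prodMk_left t).contDiffAt
      exact h1.smul (hwt1.contDiffAt
        ((hc.isOpen_chartDomain_slice t).mem_nhds (hmem (x, t) ht hxK)))
    · exact contDiffAt_const.congr_of_eventuallyEq (hZ0 x hxK)
  have hZc : HasCompactSupport Z := HasCompactSupport.intro hKπ fun x hx => by
    simp [hZdef, hAπ (x, t) hx]
  obtain ⟨hdint, hdzero⟩ := integral_div_eq_zero hZ1 hZc
  set g : E3 → ℝ := fun y => fderivWithin ℝ f (spaceTime T Γ) (y, t) (w y, 1) +
        f (y, t) * surfDiv (Γ t) (slice ν t) w y with hg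
  have hgK : ∀ y ∉ K, g y = 0 := by
    intro y hy
    have h1 : f =ᶠ[𝓝 (y, t)] fun _ => 0 := by
      filter_upwards [(hK.isClosed.isOpen_compl.preimage continuous_fst).mem_nhds
        (show (y, t) ∈ Prod.fst ⁻¹' Kᶜ from hy)] with p hp using hfK p hp
    have h2 := (h1.filter_mono nhdsWithin_le_nhds).fderivWithin_eq (s := spaceTime T Γ)
      (𝕜 := ℝ) h1.self_of_nhds
    simp only [hg, h2, hfK (y, t) hy, zero_mul, add_zero]
    rw [fderivWithin_const_apply]; rfl
  -- With `A = f · jac` and `Z = A · wt`, the transported density is `∂ₜA + div Z` in the plane: the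
  -- derivative of `jac` in `surfDiv_eq` completes the product rule. The term `div Z` integrates to
  -- zero.
  have hpoint : ∀ x, g (F.param h (x, t)) * jac h (x, t) =
      fderiv ℝ A (x, t) (0, 1) + (fderiv ℝ Z x (bvec 0) 0 + fderiv ℝ Z x (bvec 1) 1) := by
    intro x
    by_cases hxK : F.param h (x, t) ∈ K
    · have hp := hmem (x, t) ht hxK
      have hyΓ := hc.param_mem hp
      have hEd : HasFDerivAt (fun p => f (F.paramTime h p))
          (fderiv ℝ (fun p => f (F.paramTime h p)) (x, t)) (x, t) :=
        ((hE1.contDiffAt (hD.mem_nhds hp)).differentiableAt (by simp)).hasFDerivAt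
      have hJd : HasFDerivAt (jac h) (fderiv ℝ (jac h) (x, t)) (x, t) :=
        ((contDiff_jac hc.contDiff).differentiable (by simp) _).hasFDerivAt
      have hwd : HasFDerivAt wt (fderiv ℝ wt x) x :=
        ((hwt1.contDiffAt ((hc.isOpen_chartDomain_slice t).mem_nhds hp)).differentiableAt
          (by simp)).hasFDerivAt
      have hAd := hEd.mul hJd
      have hAs : HasFDerivAt (fun x => A (x, t))
          ((fderiv ℝ A (x, t)).comp (ContinuousLinearMap.inl ℝ E2 ℝ)) x :=
        HasFDerivAt.comp (g := A) (f := fun x : E2 => (x, t)) x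
          ((hA1 (x, t) ht).differentiableAt (by simp)).hasFDerivAt (hasFDerivAt_prodMk_left x t)
      have hZd := hAs.smul hwd
      have hdiv := hc.surfDiv_eq hE hp (hw.differentiableOn (by simp)) hwV hwd
      have hmat := hc.fderivWithin_spaceTime hE.normal hE.velocity hp
        (X := w (F.param h (x, t))) (σ := 1) (f := f)
        (by rw [one_mul]; exact hwV _ hyΓ)
        ((hf _ (hc.paramTime_mem hp)).differentiableWithinAt (by simp))
      have hAz : ∀ z, fderiv ℝ A (x, t) z = f (F.paramTime h (x, t)) * fderiv ℝ (jac h) (x, t) z +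
          jac h (x, t) * fderiv ℝ (fun p => f (F.paramTime h p)) (x, t) z := by
        intro z
        rw [show fderiv ℝ A (x, t) = _ from hAd.fderiv]; simp
      have hZz : ∀ b, fderiv ℝ Z x b =
          A (x, t) • fderiv ℝ wt x b + fderiv ℝ A (x, t) (b, 0) • wt x := by
        intro b
        rw [show fderiv ℝ Z x = _ from hZd.fderiv]; simp
      have hsplit : ∀ ℓ : E2 × ℝ →L[ℝ] ℝ, ℓ (wt x, 1) =
          ℓ (0, 1) + wt x 0 * ℓ (bvec 0, 0) + wt x 1 * ℓ (bvec 1, 0) := by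
        intro ℓ
        have : ((wt x, 1) : E2 × ℝ) = (0, 1) + wt x 0 • (bvec 0, 0) + wt x 1 • (bvec 1, 0) := by
          conv_lhs => rw [E2.eq_sum (wt x)]
          simp
        rw [this, map_add, map_add, map_smul, map_smul]; rfl
      have hJ0 := (jac_pos h (x, t)).ne'
      change (fderivWithin ℝ f (spaceTime T Γ) (F.paramTime h (x, t)) (w (F.param h (x, t)), 1) +
        f (F.paramTime h (x, t)) * surfDiv (Γ t) (slice ν t) w (F.param h (x, t))) * _ = _
      rw [hmat, hdiv, hZz, hZz, show A (x, t) = f (F.paramTime h (x, t)) * jac h (x, t) from rfl]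
      simp only [PiLp.add_apply, PiLp.smul_apply, smul_eq_mul, hAz]
      change (fderiv ℝ (fun p => f (F.paramTime h p)) (x, t) (wt x, 1) +
        f (F.paramTime h (x, t)) * (fderiv ℝ wt x (bvec 0) 0 + fderiv ℝ wt x (bvec 1) 1 +
          fderiv ℝ (jac h) (x, t) (wt x, 1) / jac h (x, t))) * _ = _
      rw [hsplit, hsplit]
      field_simp
      ring
    · rw [hgK _ hxK, (hA0 _ hxK).fderiv_eq, (hZ0 _ hxK).fderiv_eq]
      simp
  have hval : ∫ y in Γ t, g y ∂μHE[2] = ∫ x, fderiv ℝ A (x, t) (0, 1) := by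
    rw [hc.setIntegral_surface hΓ ht fun y hy => hgK y fun hyK => hy (hKW hyK)]
    simp only [hpoint]
    rw [integral_add hAint hdint, hdzero, add_zero]
  rw [hval]
  refine hAder.congr_of_eventuallyEq ?_
  filter_upwards [hc.isOpen_time.mem_nhds ht] with s hs
  exact hc.setIntegral_surface hΓ hs fun y hy => hfK (y, s) fun hyK => hy (hKW hyK)

end IsChart

end

/-! ### From charts to the closed surface: transport and divergence theorems. -/

section

variable {T : ℝ} {Γ : ℝ → Set E3} {ν : E3 × ℝ → E3} {V : E3 × ℝ → ℝ}

/-- By compactness it suffices to argue locally, where the surface lies in the graph over a compact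
set and has finite area by the area formula. -/
theorem IsMovingClosedSurface.measure_lt_top (hΓ : IsMovingClosedSurface T Γ) {t : ℝ}
    (ht : t ∈ Ioo 0 T) : (μHE[2] : Measure E3) (Γ t) < ⊤ := by
  refine (hΓ.isCompact ht).measure_lt_top_of_nhdsWithin fun y hy => ?_
  obtain ⟨F, h, W, I, hc, hyW, htI⟩ := exists_isChart hΓ ht hy
  obtain ⟨r, hr, hrW⟩ := Metric.nhds_basis_closedBall.mem_iff.1 (hc.isOpen_space.mem_nhds hyW)
  have hh : ContDiff ℝ 1 fun x => h (x, t) :=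
    (hc.contDiff.comp (contDiff_prodMk_left t)).of_le one_le_two
  have hA : IsCompact (F.π '' Metric.closedBall y r) :=
    (isCompact_closedBall y r).image F.π.continuous
  refine ⟨Γ t ∩ Metric.closedBall y r,
    inter_mem_nhdsWithin _ (Metric.closedBall_mem_nhds y hr), ?_⟩
  have hsub : Γ t ∩ Metric.closedBall y r ⊆
      F.graph (fun x => h (x, t)) '' (F.π '' Metric.closedBall y r) := by
    rintro z ⟨hz, hzr⟩
    exact ⟨F.π z, ⟨z, hzr, rfl⟩, hc.param_π htI (hrW hzr) hz⟩
  refine (measure_mono hsub).trans_lt ?_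
  rw [F.measure_graph_image hh hA.measurableSet]
  have hJ : Continuous fun x => areaDensity (fderiv ℝ (fun x => h (x, t)) x) :=
    continuous_areaDensity.comp (hh.continuous_fderiv one_ne_zero)
  exact Integrable.lintegral_lt_top (hJ.continuousOn.integrableOn_compact hA)

theorem IsMovingClosedSurface.integrableOn (hΓ : IsMovingClosedSurface T Γ) {t : ℝ}
    (ht : t ∈ Ioo 0 T) {g : E3 → ℝ} (hg : ContinuousOn g (Γ t)) :
    IntegrableOn g (Γ t) μHE[2] := by
  have hK := hΓ.isCompact ht
  obtain ⟨C, hC⟩ := hK.exists_bound_of_continuousOn hg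
  have : IsFiniteMeasure ((μHE[2] : Measure E3).restrict (Γ t)) :=
    ⟨by simpa using hΓ.measure_lt_top ht⟩
  refine Integrable.of_bound (hg.aestronglyMeasurable hK.measurableSet) C ?_
  filter_upwards [ae_restrict_mem hK.measurableSet] with y hy using hC y hy

/-- The surface stays in a neighbourhood of `Γ(t)` for times close to `t`. -/
theorem IsMovingClosedSurface.eventually_subset (hΓ : IsMovingClosedSurface T Γ) {t : ℝ}
    (ht : t ∈ Ioo 0 T) {O : Set E3} (hO : IsOpen O) (hsub : Γ t ⊆ O) :
    ∀ᶠ s in 𝓝 t, s ∈ Ioo 0 T ∧ Γ s ⊆ O := by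
  have hC : IsCompact ({p : E3 × ℝ | p.2 ∈ Icc 0 T ∧ p.1 ∈ Γ p.2} \ (Prod.fst ⁻¹' O)) :=
    hΓ.compact.diff (hO.preimage continuous_fst)
  have hcl := (hC.image continuous_snd).isClosed
  have htn : t ∉ Prod.snd '' ({p : E3 × ℝ | p.2 ∈ Icc 0 T ∧ p.1 ∈ Γ p.2} \ (Prod.fst ⁻¹' O)) := by
    rintro ⟨p, ⟨hp, hpO⟩, rfl⟩
    exact hpO (hsub hp.2)
  filter_upwards [hcl.isOpen_compl.mem_nhds htn, isOpen_Ioo.mem_nhds ht] with s hs hsI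
  refine ⟨hsI, fun y hy => ?_⟩
  by_contra hyO
  exact hs ⟨(y, s), ⟨⟨Ioo_subset_Icc_self hsI, hy⟩, hyO⟩, rfl⟩

namespace IsEvolution

theorem norm_normal (hE : IsEvolution T Γ ν V) {t : ℝ} (ht : t ∈ Ioo 0 T) {y : E3} (hy : y ∈ Γ t) :
    ‖ν (y, t)‖ = 1 := hE.normal.unit _ ⟨ht, hy⟩

theorem contDiffOn_normal (hE : IsEvolution T Γ ν V) {t : ℝ} (ht : t ∈ Ioo 0 T) :
    ContDiffOn ℝ 2 (slice ν t) (Γ t) :=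
  (contDiffOn_slice hE.normal.smooth ht).of_le two_le_infty

theorem contDiffOn_apply {n : WithTop ℕ∞} {S : Set E3} {f : E3 → E3} (hf : ContDiffOn ℝ n f S)
    (i : Fin 3) : ContDiffOn ℝ n (fun y => f y i) S :=
  (EuclideanSpace.proj i : E3 →L[ℝ] ℝ).contDiff.comp_contDiffOn hf

theorem contDiffOn_tanVec (hE : IsEvolution T Γ ν V) {t : ℝ} (ht : t ∈ Ioo 0 T) (i : Fin 3) :
    ContDiffOn ℝ 2 (tanVec (slice ν t) i) (Γ t) := by
  have h1 := hE.contDiffOn_normal ht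
  exact (contDiffOn_const.sub ((contDiffOn_apply h1 i).smul h1)).congr fun y _ =>
    tanVec_eq (slice ν t) i y

theorem contDiffOn_tanDeriv (hE : IsEvolution T Γ ν V) {t : ℝ} (ht : t ∈ Ioo 0 T)
    {n : WithTop ℕ∞} (hn : n + 1 ≤ 2) {f : E3 → ℝ} (hf : ContDiffOn ℝ (n + 1) f (Γ t)) (i : Fin 3) :
    ContDiffOn ℝ n (tanDeriv (Γ t) (slice ν t) i f) (Γ t) :=
  hE.contDiffOn_fderivWithin_surface ht hn hf
    ((hE.contDiffOn_tanVec ht i).of_le (le_self_add.trans hn))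
    fun _ hy => inner_tanVec_normal (n := slice ν t) (hE.norm_normal ht hy) i

theorem continuousOn_tanDeriv (hE : IsEvolution T Γ ν V) {t : ℝ} (ht : t ∈ Ioo 0 T)
    {f : E3 → ℝ} (hf : ContDiffOn ℝ 1 f (Γ t)) (i : Fin 3) :
    ContinuousOn (tanDeriv (Γ t) (slice ν t) i f) (Γ t) :=
  (hE.contDiffOn_tanDeriv (n := 0) ht (by norm_num) (by simpa using hf) i).continuousOn

theorem continuousOn_surfDiv (hE : IsEvolution T Γ ν V) {t : ℝ} (ht : t ∈ Ioo 0 T)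
    {w : E3 → E3} (hw : ContDiffOn ℝ 1 w (Γ t)) :
    ContinuousOn (surfDiv (Γ t) (slice ν t) w) (Γ t) :=
  continuousOn_finsetSum _ fun i _ => hE.continuousOn_tanDeriv ht (contDiffOn_apply hw i) i

/-- A tangential derivative can be computed from any derivative within the surface. -/
theorem tanDeriv_eq (hE : IsEvolution T Γ ν V) {t : ℝ} (ht : t ∈ Ioo 0 T) {y : E3} (hy : y ∈ Γ t)
    {f : E3 → ℝ} {f' : E3 →L[ℝ] ℝ} (hf : HasFDerivWithinAt f f' (Γ t) y) (i : Fin 3) :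
    tanDeriv (Γ t) (slice ν t) i f y = f' (tanVec (slice ν t) i y) :=
  hE.fderivWithin_surface_eq ht hy
    (inner_tanVec_normal (n := slice ν t) (hE.norm_normal ht hy) i) hf

theorem tanDeriv_add (hE : IsEvolution T Γ ν V) {t : ℝ} (ht : t ∈ Ioo 0 T) {y : E3} (hy : y ∈ Γ t)
    {f g : E3 → ℝ} (hf : DifferentiableWithinAt ℝ f (Γ t) y)
    (hg : DifferentiableWithinAt ℝ g (Γ t) y) (i : Fin 3) :
    tanDeriv (Γ t) (slice ν t) i (fun x => f x + g x) y =
      tanDeriv (Γ t) (slice ν t) i f y + tanDeriv (Γ t) (slice ν t) i g y :=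
  hE.tanDeriv_eq ht hy (hf.hasFDerivWithinAt.add hg.hasFDerivWithinAt) i

theorem surfDiv_add (hE : IsEvolution T Γ ν V) {t : ℝ} (ht : t ∈ Ioo 0 T) {y : E3} (hy : y ∈ Γ t)
    {v w : E3 → E3} (hv : DifferentiableWithinAt ℝ v (Γ t) y)
    (hw : DifferentiableWithinAt ℝ w (Γ t) y) :
    surfDiv (Γ t) (slice ν t) (fun x => v x + w x) y =
      surfDiv (Γ t) (slice ν t) v y + surfDiv (Γ t) (slice ν t) w y := by
  simp only [surfDiv, ← Finset.sum_add_distrib]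
  exact Finset.sum_congr rfl fun i _ => hE.tanDeriv_add ht hy
    (differentiableWithinAt_apply hv i) (differentiableWithinAt_apply hw i) i

/-- A partition of unity near `Γ(t)` subordinate to charts. -/
theorem exists_partition (hE : IsEvolution T Γ ν V) {t : ℝ} (ht : t ∈ Ioo 0 T) :
    ∃ (κ : Type) (_ : Fintype κ) (ρ : κ → E3 → ℝ) (O : Set E3), IsOpen O ∧ Γ t ⊆ O ∧
      (∀ i, ContDiff ℝ 1 (ρ i)) ∧ (∀ y ∈ O, ∑ i, ρ i y = 1) ∧
      ∀ i, ∃ F h W I, IsChart T Γ F h W I ∧ t ∈ I ∧ IsCompact (tsupport (ρ i)) ∧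
        tsupport (ρ i) ⊆ W := by
  have hK := hE.surface.isCompact ht
  choose! F h W I hc hyW htI using fun y hy => exists_isChart hE.surface ht (y₀ := y) hy
  obtain ⟨s, hs⟩ := hK.elim_finite_subcover (fun y : Γ t => W y)
    (fun y => (hc y y.2).isOpen_space) fun y hy => mem_iUnion.2 ⟨⟨y, hy⟩, hyW y hy⟩
  have hΩ : IsOpen (⋃ y ∈ s, W y) :=
    isOpen_biUnion fun y _ => (hc y y.2).isOpen_space
  -- The partition must sum to one on a whole neighbourhood of `Γ t`, since it is also used on `Γ s`
  -- for `s` near `t`.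
  obtain ⟨δ, hδ, hδΩ⟩ := hK.exists_cthickening_subset_open hΩ hs
  have hcth : IsCompact (Metric.cthickening δ (Γ t)) := hK.cthickening
  obtain ⟨R, hR⟩ := hcth.isBounded.subset_ball 0
  obtain ⟨f, hf⟩ := SmoothPartitionOfUnity.exists_isSubordinate (modelWithCornersSelf ℝ E3)
    (Metric.isClosed_cthickening (δ := δ) (E := Γ t))
    -- Cutting with a ball makes the supports compact.
    (fun y : s => W (y : Γ t) ∩ Metric.ball 0 R)
    (fun y => (hc _ (y : Γ t).2).isOpen_space.inter Metric.isOpen_ball) fun y hy => by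
      obtain ⟨z, hz, hzy⟩ := mem_iUnion₂.1 (hδΩ hy)
      exact mem_iUnion.2 ⟨⟨z, hz⟩, hzy, hR hy⟩
  refine ⟨s, inferInstance, fun i => f i, Metric.thickening δ (Γ t), Metric.isOpen_thickening,
    Metric.self_subset_thickening hδ _, fun i => ?_, fun y hy => ?_, fun i => ?_⟩
  · exact ((f i).contMDiff.contDiff).of_le (by exact_mod_cast natCast_le_infty 1)
  · rw [← finsum_eq_sum_of_fintype]
    exact f.sum_eq_one (Metric.thickening_subset_cthickening _ _ hy)
  · refine ⟨_, _, _, _, hc _ (i : Γ t).2,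
      htI _ (i : Γ t).2, ?_, (hf i).trans inter_subset_left⟩
    exact Metric.isCompact_of_isClosed_isBounded (isClosed_tsupport _)
      (Metric.isBounded_ball.subset ((hf i).trans inter_subset_right))

/-- The transport theorem on moving closed surfaces. -/
theorem hasDerivAt_setIntegral (hE : IsEvolution T Γ ν V) {t : ℝ} (ht : t ∈ Ioo 0 T)
    {f : E3 × ℝ → ℝ} (hf : ContDiffOn ℝ 1 f (spaceTime T Γ)) {w : E3 → E3}
    (hw : ContDiffOn ℝ 1 w (Γ t)) (hwV : ∀ y ∈ Γ t, ⟪w y, ν (y, t)⟫ = V (y, t)) :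
    HasDerivAt (fun s => ∫ y in Γ s, f (y, s) ∂μHE[2])
      (∫ y in Γ t, (fderivWithin ℝ f (spaceTime T Γ) (y, t) (w y, 1) +
        f (y, t) * surfDiv (Γ t) (slice ν t) w y) ∂μHE[2]) t := by
  obtain ⟨κ, _, ρ, O, hO, hΓO, hρ, hsum, hloc⟩ := hE.exists_partition ht
  have hΓ := hE.surface
  set fi : κ → E3 × ℝ → ℝ := fun i p => ρ i p.1 * f p with hfi
  have hfi1 : ∀ i, ContDiffOn ℝ 1 (fi i) (spaceTime T Γ) := fun i =>
    ((hρ i).comp contDiff_fst).contDiffOn.mul hf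
  have hder : ∀ i, HasDerivAt (fun s => ∫ y in Γ s, fi i (y, s) ∂μHE[2])
      (∫ y in Γ t, (fderivWithin ℝ (fi i) (spaceTime T Γ) (y, t) (w y, 1) +
        fi i (y, t) * surfDiv (Γ t) (slice ν t) w y) ∂μHE[2]) t := by
    intro i
    obtain ⟨F, h, W, I, hc, htI, hcpt, hsub⟩ := hloc i
    exact hc.hasDerivAt_setIntegral hE hcpt hsub (hfi1 i)
      (fun p hp => by simp [hfi, image_eq_zero_of_notMem_tsupport hp]) htI hw hwV
  have hfsum : ∀ p : E3 × ℝ, p.1 ∈ O → ∑ i, fi i p = f p := by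
    intro p hp
    rw [← Finset.sum_mul, hsum _ hp, one_mul]
  have htot := HasDerivAt.fun_sum fun i (_ : i ∈ Finset.univ) => hder i
  have hg : ∀ i, IntegrableOn (fun y => fderivWithin ℝ (fi i) (spaceTime T Γ) (y, t) (w y, 1) +
        fi i (y, t) * surfDiv (Γ t) (slice ν t) w y) (Γ t) μHE[2] := fun i =>
    hΓ.integrableOn ht
      ((hE.continuousOn_fderivWithin_spaceTime ht (hfi1 i) hw.continuousOn hwV).add
        ((contDiffOn_slice (hfi1 i) ht).continuousOn.mul (hE.continuousOn_surfDiv ht hw)))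
  rw [← integral_finsetSum _ fun i _ => hg i] at htot
  have hval : ∫ y in Γ t, ∑ i, (fderivWithin ℝ (fi i) (spaceTime T Γ) (y, t) (w y, 1) +
        fi i (y, t) * surfDiv (Γ t) (slice ν t) w y) ∂μHE[2] =
      ∫ y in Γ t, (fderivWithin ℝ f (spaceTime T Γ) (y, t) (w y, 1) +
        f (y, t) * surfDiv (Γ t) (slice ν t) w y) ∂μHE[2] := by
    refine setIntegral_congr_fun (hΓ.isCompact ht).measurableSet fun y hy => ?_
    have hyO := hΓO hy
    simp only [Finset.sum_add_distrib, ← Finset.sum_mul, hfsum (y, t) hyO]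
    congr 1
    -- The sum of the chosen derivatives is some derivative of `f` within `S_T`; it agrees with the
    -- chosen one in the tangent direction `(w, 1)`.
    have h1 : HasFDerivWithinAt (fun p => ∑ i, fi i p)
        (∑ i, fderivWithin ℝ (fi i) (spaceTime T Γ) (y, t)) (spaceTime T Γ) (y, t) :=
      HasFDerivWithinAt.fun_sum fun i _ =>
        ((hfi1 i (y, t) ⟨ht, hy⟩).differentiableWithinAt (by simp)).hasFDerivWithinAt
    have h2 := h1.congr_of_eventuallyEq (f₁ := f) (by
      filter_upwards [mem_nhdsWithin_of_mem_nhds ((hO.preimage continuous_fst).mem_nhds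
        (show (y, t) ∈ Prod.fst ⁻¹' O from hyO))] with p hp using (hfsum p hp).symm)
      (hfsum (y, t) hyO).symm
    rw [hE.fderivWithin_spaceTime_eq ht hy (hwV y hy) h2]
    simp
  rw [hval] at htot
  refine htot.congr_of_eventuallyEq ?_
  filter_upwards [hΓ.eventually_subset ht hO hΓO] with s hs
  have hint : ∀ i, IntegrableOn (fun y => fi i (y, s)) (Γ s) μHE[2] := fun i =>
    hΓ.integrableOn hs.1 (contDiffOn_slice (hfi1 i) hs.1).continuousOn
  rw [← integral_finsetSum _ fun i _ => hint i]
  exact setIntegral_congr_fun (hΓ.isCompact hs.1).measurableSet fun y hy =>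
    (hfsum (y, s) (hs.2 hy)).symm

/-- The divergence theorem for tangential fields on closed surfaces. -/
theorem setIntegral_surfDiv_eq_zero (hE : IsEvolution T Γ ν V) {t : ℝ} (ht : t ∈ Ioo 0 T)
    {w : E3 → E3} (hw : ContDiffOn ℝ 1 w (Γ t)) (hwV : ∀ y ∈ Γ t, ⟪w y, ν (y, t)⟫ = V (y, t))
    {Y : E3 → E3} (hY : ContDiffOn ℝ 1 Y (Γ t)) (hYν : ∀ y ∈ Γ t, ⟪Y y, ν (y, t)⟫ = 0) :
    ∫ y in Γ t, surfDiv (Γ t) (slice ν t) Y y ∂μHE[2] = 0 := by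
  -- The area of `Γ s` is differentiated with two admissible velocities, `w` and `w + Y`; uniqueness
  -- of the derivative equates the two integrals.
  have h1 := hE.hasDerivAt_setIntegral ht (f := fun _ => (1 : ℝ)) contDiffOn_const hw hwV
  have h2 := hE.hasDerivAt_setIntegral ht (f := fun _ => (1 : ℝ)) contDiffOn_const (hw.add hY)
    fun y hy => by
      rw [inner_add_left, hwV y hy, hYν y hy, add_zero]
  have h3 := h1.unique h2
  simp only [fderivWithin_const_apply, zero_apply, zero_add, one_mul] at h3
  have h4 : ∫ y in Γ t, surfDiv (Γ t) (slice ν t) (fun x => w x + Y x) y ∂μHE[2] =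
      ∫ y in Γ t, (surfDiv (Γ t) (slice ν t) w y + surfDiv (Γ t) (slice ν t) Y y) ∂μHE[2] :=
    setIntegral_congr_fun (hE.surface.isCompact ht).measurableSet fun y hy =>
      hE.surfDiv_add ht hy ((hw y hy).differentiableWithinAt (by simp))
        ((hY y hy).differentiableWithinAt (by simp))
  rw [h4, integral_add (hE.surface.integrableOn ht (hE.continuousOn_surfDiv ht hw))
    (hE.surface.integrableOn ht (hE.continuousOn_surfDiv ht hY))] at h3
  linarith

end IsEvolution

end

/-! ### Algebra of the tangential projection and the projected strain. -/

theorem frobSq_eq_trace (M : Matrix (Fin 3) (Fin 3) ℝ) : frobSq M = (M.transpose * M).trace := by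
  simp only [frobSq, Matrix.trace, Matrix.diag, Matrix.mul_apply, Matrix.transpose_apply]
  rw [Finset.sum_comm]
  exact Finset.sum_congr rfl fun i _ => Finset.sum_congr rfl fun j _ => sq _

theorem sum_mul_eq_trace (M G : Matrix (Fin 3) (Fin 3) ℝ) :
    ∑ i, ∑ j, M i j * G i j = (M.transpose * G).trace := by
  simp only [Matrix.trace, Matrix.diag, Matrix.mul_apply, Matrix.transpose_apply]
  rw [Finset.sum_comm]

/-- The dissipation identity `M : G = |M|²` for the projected symmetric part `M` of `G`. -/
theorem sum_mul_proj_eq_frobSq {P G : Matrix (Fin 3) (Fin 3) ℝ} (hPt : P.transpose = P)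
    (hPP : P * P = P) :
    ∑ i, ∑ j, (P * ((1 / 2 : ℝ) • (G + G.transpose)) * P) i j * G i j =
      frobSq (P * ((1 / 2 : ℝ) • (G + G.transpose)) * P) := by
  set D := (1 / 2 : ℝ) • (G + G.transpose) with hD
  set M := P * D * P with hM
  have hDt : D.transpose = D := by
    rw [hD, Matrix.transpose_smul, Matrix.transpose_add, Matrix.transpose_transpose, add_comm]
  have hMt : M.transpose = M := by
    rw [hM, Matrix.transpose_mul, Matrix.transpose_mul, hPt, hDt, Matrix.mul_assoc]
  have hPM : P * M = M := by rw [hM, ← Matrix.mul_assoc, ← Matrix.mul_assoc, hPP]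
  have hMP : M * P = M := by rw [hM, Matrix.mul_assoc, hPP]
  have h1 : (M * G.transpose).trace = (M * G).trace := by
    rw [← Matrix.trace_transpose, Matrix.transpose_mul, Matrix.transpose_transpose, hMt,
      Matrix.trace_mul_comm]
  -- A symmetric `M` sees only the symmetric part of `G`.
  have h2 : (M * D).trace = (M * G).trace := by
    rw [hD, Matrix.mul_smul, Matrix.mul_add, Matrix.trace_smul, Matrix.trace_add, h1, smul_eq_mul]
    ring
  rw [sum_mul_eq_trace, frobSq_eq_trace, hMt, ← h2]
  -- The outer projection is then absorbed into `M` by cyclicity of the trace.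
  have hMM : M * M = M * D * P := by
    calc M * M = M * (P * D * P) := congrArg (M * ·) hM
      _ = M * P * D * P := by simp only [Matrix.mul_assoc]
      _ = M * D * P := by rw [hMP]
  rw [hMM, Matrix.trace_mul_comm _ P, ← Matrix.mul_assoc, hPM]

theorem tanProj_apply (n : E3 → E3) (y : E3) (i j : Fin 3) :
    tanProj n y i j = (1 : Matrix (Fin 3) (Fin 3) ℝ) i j - n y i * n y j := rfl

theorem tanProj_transpose (n : E3 → E3) (y : E3) : (tanProj n y).transpose = tanProj n y := by
  ext i j
  rw [Matrix.transpose_apply, tanProj_apply, tanProj_apply, ← Matrix.transpose_apply 1,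
    Matrix.transpose_one, mul_comm]

theorem sum_normal_mul_tanProj {n : E3 → E3} {y : E3} (hn : ‖n y‖ = 1) (j : Fin 3) :
    ∑ i, n y i * tanProj n y i j = 0 := by
  have h : ∑ i, n y i * n y i = 1 := by
    rw [← E3.inner_eq, real_inner_self_eq_norm_sq, hn, one_pow]
  simp only [tanProj_apply, mul_sub, Finset.sum_sub_distrib, Matrix.one_apply, mul_ite, mul_one,
    mul_zero, Finset.sum_ite_eq', Finset.mem_univ, if_true, ← mul_assoc, ← Finset.sum_mul, h,
    one_mul, sub_self]

theorem tanProj_mul_self {n : E3 → E3} {y : E3} (hn : ‖n y‖ = 1) :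
    tanProj n y * tanProj n y = tanProj n y := by
  have h2 : (Matrix.of fun i j => n y i * n y j) * tanProj n y = 0 := by
    ext i j
    simp only [Matrix.mul_apply, Matrix.of_apply, mul_assoc, ← Finset.mul_sum,
      sum_normal_mul_tanProj hn, mul_zero, Matrix.zero_apply]
  calc tanProj n y * tanProj n y
      = (1 - Matrix.of fun i j => n y i * n y j) * tanProj n y := rfl
    _ = tanProj n y := by rw [Matrix.sub_mul, h2, Matrix.one_mul, sub_zero]

theorem sum_normal_mul_projStrain {S : Set E3} {n v : E3 → E3} {y : E3} (hn : ‖n y‖ = 1)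
    (j : Fin 3) : ∑ i, n y i * projStrain S n v y i j = 0 := by
  have h : Matrix.vecMul (fun i => n y i) (tanProj n y) = 0 := by
    ext k; exact sum_normal_mul_tanProj hn k
  have h2 : Matrix.vecMul (fun i => n y i) (projStrain S n v y) = 0 := by
    rw [projStrain, ← Matrix.vecMul_vecMul, ← Matrix.vecMul_vecMul, h]; simp
  exact congrFun h2 j

theorem sum_normal_smul_tanVec {n : E3 → E3} {y : E3} (hn : ‖n y‖ = 1) :
    ∑ i, n y i • tanVec n i y = 0 := by
  refine ext_inner_right ℝ fun a => ?_
  have h : ∑ i, n y i * n y i = 1 := by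
    rw [← E3.inner_eq, real_inner_self_eq_norm_sq, hn, one_pow]
  simp only [sum_inner, real_inner_smul_left, inner_tanVec, mul_sub, Finset.sum_sub_distrib,
    ← mul_assoc, ← Finset.sum_mul, h, inner_zero_left, ← E3.inner_eq]
  ring

theorem sum_normal_mul_tanDeriv {S : Set E3} {n : E3 → E3} {y : E3} (hn : ‖n y‖ = 1) (f : E3 → ℝ) :
    ∑ i, n y i * tanDeriv S n i f y = 0 := by
  have h := congrArg (fderivWithin ℝ f S y) (sum_normal_smul_tanVec hn)
  simpa [map_sum, ← tanDeriv_def] using h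

/-! ### The energy flux and the local energy balance. -/

namespace IsEvolution

variable {T : ℝ} {Γ : ℝ → Set E3} {ν : E3 × ℝ → E3} {V : E3 × ℝ → ℝ}

theorem contDiffOn_tanProj (hE : IsEvolution T Γ ν V) {t : ℝ} (ht : t ∈ Ioo 0 T) (i j : Fin 3) :
    ContDiffOn ℝ 2 (fun y => tanProj (slice ν t) y i j) (Γ t) :=
  contDiffOn_const.sub ((contDiffOn_apply (hE.contDiffOn_normal ht) i).mul
    (contDiffOn_apply (hE.contDiffOn_normal ht) j))

theorem contDiffOn_projStrain (hE : IsEvolution T Γ ν V) {t : ℝ} (ht : t ∈ Ioo 0 T) {v : E3 → E3}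
    (hv : ContDiffOn ℝ 2 v (Γ t)) (i j : Fin 3) :
    ContDiffOn ℝ 1 (fun y => projStrain (Γ t) (slice ν t) v y i j) (Γ t) := by
  have hP : ∀ i j, ContDiffOn ℝ 1 (fun y => tanProj (slice ν t) y i j) (Γ t) := fun i j =>
    (hE.contDiffOn_tanProj ht i j).of_le one_le_two
  have hG : ∀ i j, ContDiffOn ℝ 1 (tanDeriv (Γ t) (slice ν t) i fun x => v x j) (Γ t) := fun i j =>
    hE.contDiffOn_tanDeriv ht (by norm_num)
      (by rw [one_add_one_eq_two]; exact contDiffOn_apply hv j) i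
  have hD : ∀ i j, ContDiffOn ℝ 1 (fun y => tanStrain (Γ t) (slice ν t) v y i j) (Γ t) :=
    fun i j => contDiffOn_const.mul ((hG i j).add (hG j i))
  simp only [projStrain, Matrix.mul_apply]
  exact ContDiffOn.sum fun k _ => (ContDiffOn.sum fun l _ => (hP i l).mul (hD l k)).mul (hP k j)

/-- The tangential field whose divergence appears in the local energy balance: the viscous stress
acting on the velocity minus the pressure times the tangential velocity. -/
def energyFlux (μ₀ : ℝ) (Γ : ℝ → Set E3) (ν v : E3 × ℝ → E3) (q : E3 × ℝ → ℝ) (t : ℝ) (y : E3) :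
    E3 :=
  WithLp.toLp 2 fun i =>
    2 * μ₀ * ∑ j, projStrain (Γ t) (slice ν t) (slice v t) y i j * v (y, t) j -
      q (y, t) * (v (y, t) i - ⟪v (y, t), ν (y, t)⟫ * ν (y, t) i)

variable {μ₀ : ℝ} {v : E3 × ℝ → E3} {q q₁ : E3 × ℝ → ℝ}

theorem contDiffOn_energyFlux (hE : IsEvolution T Γ ν V) (hv : ContDiffOn ℝ 2 v (spaceTime T Γ))
    (hq : ContDiffOn ℝ 1 q (spaceTime T Γ)) {t : ℝ} (ht : t ∈ Ioo 0 T) :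
    ContDiffOn ℝ 1 (energyFlux μ₀ Γ ν v q t) (Γ t) := by
  have hvt := contDiffOn_slice hv ht
  have hv1 : ContDiffOn ℝ 1 (slice v t) (Γ t) := hvt.of_le one_le_two
  have hn1 : ContDiffOn ℝ 1 (slice ν t) (Γ t) := (hE.contDiffOn_normal ht).of_le one_le_two
  have hq1 := contDiffOn_slice hq ht
  refine contDiffOn_euclidean.2 fun i => ?_
  refine ContDiffOn.sub (contDiffOn_const.mul (ContDiffOn.sum fun j _ => ?_)) (hq1.mul ?_)
  · exact (hE.contDiffOn_projStrain ht hvt i j).mul (contDiffOn_apply hv1 j)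
  · exact (contDiffOn_apply hv1 i).sub ((hv1.inner ℝ hn1).mul (contDiffOn_apply hn1 i))

/-- The projected strain annihilates the normal, and the pressure part contains only the tangential
velocity. Tangency is what the divergence theorem requires of the flux. -/
theorem inner_energyFlux (hE : IsEvolution T Γ ν V) {t : ℝ} (ht : t ∈ Ioo 0 T) {y : E3}
    (hy : y ∈ Γ t) : ⟪energyFlux μ₀ Γ ν v q t y, ν (y, t)⟫ = 0 := by
  have hn := hE.norm_normal ht hy
  have h1 : ∑ i, ν (y, t) i * ν (y, t) i = 1 := by
    rw [← E3.inner_eq, real_inner_self_eq_norm_sq, hn, one_pow]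
  have h2 := sum_normal_mul_projStrain (S := Γ t) (n := slice ν t) (v := slice v t) hn
  have h20 := h2 0
  have h21 := h2 1
  have h22 := h2 2
  rw [E3.inner_eq]
  simp only [energyFlux, E3.inner_eq (v (y, t)), Fin.sum_univ_three] at h1 h20 h21 h22 ⊢
  linear_combination 2 * μ₀ * (v (y, t) 0 * h20 + v (y, t) 1 * h21 + v (y, t) 2 * h22) +
    q (y, t) * (v (y, t) 0 * ν (y, t) 0 + v (y, t) 1 * ν (y, t) 1 + v (y, t) 2 * ν (y, t) 2) * h1

theorem tanDeriv_energyFlux (hE : IsEvolution T Γ ν V) (hv : ContDiffOn ℝ 2 v (spaceTime T Γ))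
    (hq : ContDiffOn ℝ 1 q (spaceTime T Γ)) {t : ℝ} (ht : t ∈ Ioo 0 T) {y : E3} (hy : y ∈ Γ t)
    (i : Fin 3) :
    tanDeriv (Γ t) (slice ν t) i (fun x => energyFlux μ₀ Γ ν v q t x i) y =
      2 * μ₀ * ∑ j, (projStrain (Γ t) (slice ν t) (slice v t) y i j *
          tanDeriv (Γ t) (slice ν t) i (fun x => slice v t x j) y +
        slice v t y j * tanDeriv (Γ t) (slice ν t) i
          (fun x => projStrain (Γ t) (slice ν t) (slice v t) x i j) y) -
      (slice q t y * (tanDeriv (Γ t) (slice ν t) i (fun x => slice v t x i) y -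
        (⟪slice v t y, slice ν t y⟫ * tanDeriv (Γ t) (slice ν t) i (fun x => slice ν t x i) y +
          slice ν t y i *
            tanDeriv (Γ t) (slice ν t) i (fun x => ⟪slice v t x, slice ν t x⟫) y)) +
        (slice v t y i - ⟪slice v t y, slice ν t y⟫ * slice ν t y i) *
          tanDeriv (Γ t) (slice ν t) i (slice q t) y) := by
  have hvt := contDiffOn_slice hv ht
  have hv1 : ContDiffOn ℝ 1 (slice v t) (Γ t) := hvt.of_le one_le_two
  have hn1 : ContDiffOn ℝ 1 (slice ν t) (Γ t) := (hE.contDiffOn_normal ht).of_le one_le_two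
  have hd : ∀ {f : E3 → ℝ}, ContDiffOn ℝ 1 f (Γ t) →
      HasFDerivWithinAt f (fderivWithin ℝ f (Γ t) y) (Γ t) y := fun hf =>
    ((hf y hy).differentiableWithinAt (by simp)).hasFDerivWithinAt
  have hsum := HasFDerivWithinAt.fun_sum fun j (_ : j ∈ Finset.univ) =>
    (hd (hE.contDiffOn_projStrain ht hvt i j)).mul (hd (contDiffOn_apply hv1 j))
  have h1 := (hsum.const_mul (2 * μ₀)).sub ((hd (contDiffOn_slice hq ht)).mul
    ((hd (contDiffOn_apply hv1 i)).sub ((hd (hv1.inner ℝ hn1)).mul (hd (contDiffOn_apply hn1 i)))))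
  rw [hE.tanDeriv_eq ht hy (f := fun x => energyFlux μ₀ Γ ν v q t x i) h1 i]
  simp only [tanDeriv_def, sub_apply, add_apply, smul_apply, sum_apply, smul_eq_mul, Pi.sub_apply,
    Pi.mul_apply]

/-- Here `G i j`, `dM i j`, `dn i`, `dq i`, `dU i` stand for the `i`-th tangential derivatives of `v
j`, `M i j`, `n i`, `q` and `U = v · n`. The unwanted terms vanish by incompressibility and because
tangential gradients are orthogonal to the normal. -/
theorem energyFlux_algebra {M G dM : Fin 3 → Fin 3 → ℝ} {v n dn dq dU : Fin 3 → ℝ} {q U μ : ℝ}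
    (hG : ∑ i, G i i = 0) (hq : ∑ i, n i * dq i = 0) (hU : ∑ i, n i * dU i = 0) :
    ∑ i, (2 * μ * ∑ j, (M i j * G i j + v j * dM i j) -
        (q * (G i i - (U * dn i + n i * dU i)) + (v i - U * n i) * dq i)) =
      2 * μ * ∑ j, v j * ∑ i, dM i j + 2 * μ * ∑ i, ∑ j, M i j * G i j - ∑ i, v i * dq i -
        q * (-∑ i, dn i) * U := by
  simp only [Fin.sum_univ_three] at *
  linear_combination (-q) * hG + q * hU + U * hq

theorem surfDiv_energyFlux (hE : IsEvolution T Γ ν V) (hv : ContDiffOn ℝ 2 v (spaceTime T Γ))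
    (hq : ContDiffOn ℝ 1 q (spaceTime T Γ)) {t : ℝ} (ht : t ∈ Ioo 0 T) {y : E3} (hy : y ∈ Γ t)
    (hdiv : surfDiv (Γ t) (slice ν t) (slice v t) y = 0) :
    surfDiv (Γ t) (slice ν t) (energyFlux μ₀ Γ ν v q t) y =
      2 * μ₀ * ⟪v (y, t),
        surfDivMatrix (Γ t) (slice ν t) (projStrain (Γ t) (slice ν t) (slice v t)) y⟫ +
      2 * μ₀ * frobSq (projStrain (Γ t) (slice ν t) (slice v t) y) -
      ⟪v (y, t), tanGrad (Γ t) (slice ν t) (slice q t) y⟫ -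
      q (y, t) * meanCurv (Γ t) (slice ν t) y * ⟪v (y, t), ν (y, t)⟫ := by
  have hn := hE.norm_normal ht hy
  have hfrob := sum_mul_proj_eq_frobSq (G := tanGradMatrix (Γ t) (slice ν t) (slice v t) y)
    (tanProj_transpose (slice ν t) y) (tanProj_mul_self hn)
  rw [show frobSq (projStrain (Γ t) (slice ν t) (slice v t) y) = _ from hfrob.symm,
    E3.inner_eq _ (surfDivMatrix _ _ _ _), E3.inner_eq _ (tanGrad _ _ _ _)]
  refine (Finset.sum_congr rfl fun i _ => hE.tanDeriv_energyFlux hv hq ht hy i).trans ?_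
  exact energyFlux_algebra hdiv (sum_normal_mul_tanDeriv (n := slice ν t) hn _)
    (sum_normal_mul_tanDeriv (n := slice ν t) hn _)

/-- The local energy balance. -/
theorem energy_identity (hE : IsEvolution T Γ ν V) (hv : ContDiffOn ℝ 2 v (spaceTime T Γ))
    (hq : ContDiffOn ℝ 1 q (spaceTime T Γ)) (hNS : SolvesLimitNavierStokes T μ₀ Γ ν v q q₁)
    (hvV : ∀ p ∈ spaceTime T Γ, ⟪v p, ν p⟫ = V p) {t : ℝ} (ht : t ∈ Ioo 0 T) {y : E3}
    (hy : y ∈ Γ t) :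
    fderivWithin ℝ (fun p => ‖v p‖ ^ 2 / 2) (spaceTime T Γ) (y, t) (v (y, t), 1) +
        ‖v (y, t)‖ ^ 2 / 2 * surfDiv (Γ t) (slice ν t) (slice v t) y =
      surfDiv (Γ t) (slice ν t) (energyFlux μ₀ Γ ν v q t) y +
      -2 * μ₀ * frobSq (projStrain (Γ t) (slice ν t) (slice v t) y) +
      (q (y, t) * meanCurv (Γ t) (slice ν t) y - q₁ (y, t)) * V (y, t) := by
  have hp : (y, t) ∈ spaceTime T Γ := ⟨ht, hy⟩
  have hdiv := hNS.continuity _ hp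
  have hmom := hNS.momentum _ hp
  have hV := hvV _ hp
  have hvd : HasFDerivWithinAt v (fderivWithin ℝ v (spaceTime T Γ) (y, t)) (spaceTime T Γ) (y, t) :=
    ((hv _ hp).differentiableWithinAt (by simp)).hasFDerivWithinAt
  have hed : HasFDerivWithinAt (fun p => ‖v p‖ ^ 2 / 2)
      ((2 : ℝ)⁻¹ • (2 • (innerSL ℝ (v (y, t))).comp (fderivWithin ℝ v (spaceTime T Γ) (y, t))))
      (spaceTime T Γ) (y, t) := by
    simp only [div_eq_mul_inv]
    exact hvd.norm_sq.mul_const _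
  have hen : fderivWithin ℝ (fun p => ‖v p‖ ^ 2 / 2) (spaceTime T Γ) (y, t) (v (y, t), 1) =
      ⟪v (y, t), materialDeriv T Γ v v (y, t)⟫ := by
    rw [hE.fderivWithin_spaceTime_eq ht hy hV hed]
    simp [materialDeriv]
  -- The momentum equation tested with the velocity; its normal pressure term becomes `q₁ V`.
  have hin := congrArg (fun z => ⟪v (y, t), z⟫) hmom
  simp only [inner_add_right, real_inner_smul_right, hV] at hin
  rw [hen, surfDiv_energyFlux hE hv hq ht hy hdiv, hdiv, hV]
  linear_combination hin

end IsEvolution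

end MovingSurface

end

/-! ### The energy identity. -/

open MovingSurface
theorem lemma5p5 (T μ₀ : ℝ) (hμ₀ : 0 < μ₀)
    (Γ : ℝ → Set E3) (hΓ : IsMovingClosedSurface T Γ)
    (ν : E3 × ℝ → E3) (hν : IsUnitOutwardNormal T Γ ν)
    (V : E3 × ℝ → ℝ) (hV : IsNormalVelocity T Γ ν V)
    (v : E3 × ℝ → E3) (q q₁ : E3 × ℝ → ℝ)
    (hv : ContDiffOn ℝ 2 v (spaceTime T Γ))
    (hq : ContDiffOn ℝ 1 q (spaceTime T Γ))
    (hq₁ : ContinuousOn q₁ (spaceTime T Γ))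
    (hNS : SolvesLimitNavierStokes T μ₀ Γ ν v q q₁)
    (hvV : ∀ p ∈ spaceTime T Γ, ⟪v p, ν p⟫ = V p) :
    ∀ t ∈ Ioo 0 T,
      IntegrableOn (fun y => ‖v (y, t)‖ ^ 2 / 2) (Γ t) μHE[2] ∧
      IntegrableOn (fun y => frobSq (projStrain (Γ t) (slice ν t) (slice v t) y)) (Γ t) μHE[2] ∧
      IntegrableOn (fun y => (q (y, t) * meanCurv (Γ t) (slice ν t) y - q₁ (y, t)) * V (y, t))
        (Γ t) μHE[2] ∧
      HasDerivAt (fun s => ∫ y in Γ s, ‖v (y, s)‖ ^ 2 / 2 ∂μHE[2])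
        (-2 * μ₀ * (∫ y in Γ t, frobSq (projStrain (Γ t) (slice ν t) (slice v t) y) ∂μHE[2])
          + ∫ y in Γ t, (q (y, t) * meanCurv (Γ t) (slice ν t) y - q₁ (y, t)) * V (y, t) ∂μHE[2])
        t := by
  intro t ht
  have hE : IsEvolution T Γ ν V := ⟨hΓ, hν, hV⟩
  have hvt : ContDiffOn ℝ 2 (slice v t) (Γ t) := contDiffOn_slice hv ht
  have hv1 : ContDiffOn ℝ 1 (slice v t) (Γ t) := hvt.of_le one_le_two
  have hn1 : ContDiffOn ℝ 1 (slice ν t) (Γ t) := (hE.contDiffOn_normal ht).of_le one_le_two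
  have hwV : ∀ y ∈ Γ t, ⟪slice v t y, ν (y, t)⟫ = V (y, t) := fun y hy => hvV (y, t) ⟨ht, hy⟩
  have henergy : ContDiffOn ℝ 1 (fun p => ‖v p‖ ^ 2 / 2) (spaceTime T Γ) :=
    ((hv.of_le one_le_two).norm_sq ℝ).div_const 2
  have hint₁ := hΓ.integrableOn ht (contDiffOn_slice henergy ht).continuousOn
  have hint₂ : IntegrableOn (fun y => frobSq (projStrain (Γ t) (slice ν t) (slice v t) y)) (Γ t)
      μHE[2] :=
    hΓ.integrableOn ht (continuousOn_finsetSum _ fun i _ => continuousOn_finsetSum _ fun j _ =>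
      (hE.contDiffOn_projStrain ht hvt i j).continuousOn.pow 2)
  -- Continuity of `V` is inherited from `v · ν`.
  have hVc : ContinuousOn (fun y => V (y, t)) (Γ t) :=
    (hv1.inner ℝ hn1).continuousOn.congr fun y hy => (hwV y hy).symm
  have hq₁t : ContinuousOn (fun y => q₁ (y, t)) (Γ t) :=
    hq₁.comp (f := fun y : E3 => (y, t)) (by fun_prop) fun y hy => ⟨ht, hy⟩
  have hint₃ : IntegrableOn
      (fun y => (q (y, t) * meanCurv (Γ t) (slice ν t) y - q₁ (y, t)) * V (y, t)) (Γ t) μHE[2] :=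
    hΓ.integrableOn ht ((((contDiffOn_slice hq ht).continuousOn.mul
      (hE.continuousOn_surfDiv ht hn1).neg).sub hq₁t).mul hVc)
  refine ⟨hint₁, hint₂, hint₃, ?_⟩
  have hflux := hE.contDiffOn_energyFlux (μ₀ := μ₀) hv hq ht
  -- The fluid velocity itself serves as the transporting field, here and in the divergence theorem.
  have hder := hE.hasDerivAt_setIntegral ht henergy hv1 hwV
  have hzero := hE.setIntegral_surfDiv_eq_zero ht hv1 hwV hflux
    fun y hy => hE.inner_energyFlux ht hy
  rw [setIntegral_congr_fun (hΓ.isCompact ht).measurableSet fun y hy =>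
    hE.energy_identity hv hq hNS hvV ht hy] at hder
  have hint₀ := hΓ.integrableOn ht (hE.continuousOn_surfDiv ht hflux)
  have hint₄ := hint₂.const_mul (-2 * μ₀)
  have hint₅ : IntegrableOn (fun y => surfDiv (Γ t) (slice ν t)
      (IsEvolution.energyFlux μ₀ Γ ν v q t) y +
        -2 * μ₀ * frobSq (projStrain (Γ t) (slice ν t) (slice v t) y)) (Γ t) μHE[2] :=
    hint₀.add hint₄
  rw [integral_add hint₅ hint₃, integral_add hint₀ hint₄,
    hzero, zero_add, integral_const_mul] at hder
  exact hder
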